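/- Let $a<b<c<d$ be natural numbers with $\gcd(a,b,c,d)=1$ such that every number of the form $a^pb^qc^ld^f$ ($p,q,l,f\in\mathbb N_0$) has only one such representation (for example, $a\ge 2$ and $a,b,c,d$ pairwise coprime). Put $$N_{a,b,c,d}(x)=\#\{(p,q,l,f)\in\mathbb N_0^4: a^pb^qc^ld^f\le x\},\qquad S_{a,b,c,d}=\{a^pb^qc^ld^f:p,q,l,f\in\mathbb N_0\},$$ let $\chi_{S_{a,b,c,d}}$ be the characteristic function of $S_{a,b,c,d}$, and let $B_1^*(\{t\})=\{t\}-\tfrac12$ for $t\notin\mathbb Z$ and $B_1^*(\{t\})=0$ for $t\in\mathbb Z$, where $\{t\}$ is the fractional part. Write $L_u=\log u$, and let $u,v,w,z$ denote distinct elements of $\{a,b,c,d\}$. For real $x\ge1$, $X=\log x$ and $R>0$ define the partial sums $$C^{(1)}_{u;v}(R)=\sum_{k=1}^{\lfloor R L_u\rfloor}\frac{\cos\left(\frac{\pi kL_v}{L_u}\right)\cos\left(2\pi k\frac{X}{L_u}\right)}{k\,\sin\left(\frac{\pi kL_v}{L_u}\right)},$$ $$C^{(2)}_{u;v,w}(R)=\sum_{k=1}^{\lfloor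 R L_u\rfloor}\frac{\cos\left(\frac{\pi kL_v}{L_u}\right)\cos\left(\frac{\pi kL_w}{L_u}\right)\sin\left(2\pi k\frac{X}{L_u}\right)}{k\,\sin\left(\frac{\pi kL_v}{L_u}\right)\sin\left(\frac{\pi kL_w}{L_u}\right)},$$ $$C^{(3)}_{u;v,w,z}(R)=\sum_{k=1}^{\lfloor R L_u\rfloor}\frac{\cos\left(\frac{\pi kL_v}{L_u}\right)\cos\left(\frac{\pi kL_w}{L_u}\right)\cos\left(\frac{\pi kL_z}{L_u}\right)\cos\left(2\pi k\frac{X}{L_u}\right)}{k\,\sin\left(\frac{\pi kL_v}{L_u}\right)\sin\left(\frac{\pi kL_w}{L_u}\right)\sin\left(\frac{\pi kL_z}{L_u}\right)}.$$ Then there is a sequence $R_j\to\infty$, not depending on $x$, such that for every real $x\ge1$ the following limits exist for all pairs $\{u,v\}$ and all triples $\{u,v,w\}$ in $\{a,b,c,d\}$: $$P_{uv}=\lim_{j\to\infty}\left(C^{(1)}_{u;v}(R_j)+C^{(1)}_{v;u}(R_j)\right),\qquad T_{uvw}=\lim_{j\to\infty}\left(C^{(2)}_{u;v,w}(R_j)+C^{(2)}_{v;u,w}(R_j)+C^{(2)}_{w;u,v}(R_j)\right),$$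 $$Q=\lim_{j\to\infty}\left(C^{(3)}_{a;b,c,d}(R_j)+C^{(3)}_{b;a,c,d}(R_j)+C^{(3)}_{c;a,b,d}(R_j)+C^{(3)}_{d;a,b,c}(R_j)\right),$$ and $$N_{a,b,c,d}(x)=M(X)-\frac18\sum_{u}B_1^*\left(\left\{\frac{X}{L_u}\right\}\right)-\frac1{8\pi}\sum_{\{u,v\}}P_{uv}-\frac1{8\pi}\sum_{\{u,v,w\}}T_{uvw}+\frac1{8\pi}Q+\frac12\chi_{S_{a,b,c,d}}(x).$$ Here the sums run over all elements, all two-element subsets and all three-element subsets of $\{a,b,c,d\}$, and $M$ is the quartic polynomial $$\begin{aligned}M(X)={}&\frac{X^4}{24L_aL_bL_cL_d}+\sum_{\{u,v,w\}}\frac{X^3}{12L_uL_vL_w}+\sum_{u}\frac{L_uX^2}{24L_vL_wL_z}+\sum_{\{u,v\}}\frac{X^2}{8L_uL_v}+\sum_u\frac{X}{8L_u}+\sum_{u}\ \sum_{\{v,w\}\not\ni u}\frac{L_uX}{24L_vL_w}\\&+\frac1{16}+\sum_{u\ne v}\frac{L_u}{48L_v}+\sum_{\{u,v\}}\frac{L_uL_v}{144L_wL_z}-\sum_u\frac{L_u^3}{720L_vL_wL_z},\end{aligned}$$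 where in the sum over $u\neq v$ both orders are counted, and in each summand those of the letters $v,w,z$ that are not summation indices denote the remaining elements of $\{a,b,c,d\}$. In particular, the same statement holds for $(a,b,c,d)=(2,3,5,7)$, that is, for the counting function $N_{2,3,5,7}(x)$ of the $7$-smooth numbers. -/

import Mathlib

open Filter Topology

namespace SmoothCount

noncomputable section

/-- `N_{a,b,c,d}(x)`: the number of exponent vectors `(p, q, l, f)` of natural numbers with
`a ^ p * b ^ q * c ^ l * d ^ f ≤ x`. -/
def count (a b c d : ℕ) (x : ℝ) : ℕ :=
  Set.ncard {e : ℕ × ℕ × ℕ × ℕ |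
    ((a ^ e.1 * b ^ e.2.1 * c ^ e.2.2.1 * d ^ e.2.2.2 : ℕ) : ℝ) ≤ x}

/-- `S_{a,b,c,d}`, viewed as a set of real numbers. -/
def smoothSet (a b c d : ℕ) : Set ℝ :=
  {y | ∃ p q l f : ℕ, y = ((a ^ p * b ^ q * c ^ l * d ^ f : ℕ) : ℝ)}

/-- The characteristic function `χ` of `S_{a,b,c,d}`. -/
def chi (a b c d : ℕ) (x : ℝ) : ℝ :=
  (smoothSet a b c d).indicator (fun _ => 1) x

/-- Every number of the form `a ^ p * b ^ q * c ^ l * d ^ f` has only one such representation. -/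
def UniqueRep (a b c d : ℕ) : Prop :=
  Function.Injective (fun e : ℕ × ℕ × ℕ × ℕ =>
    a ^ e.1 * b ^ e.2.1 * c ^ e.2.2.1 * d ^ e.2.2.2)

/-- `B₁*({t})`: it is `{t} - 1/2` if `t` is not an integer and `0` if `t` is an integer. -/
def bernoulliOneStar (t : ℝ) : ℝ :=
  if Int.fract t = 0 then 0 else Int.fract t - 1 / 2

/-- The quartic polynomial in `X = log x`, with `A, B, C, D` the logarithms of the four bases. -/
def mainPoly (A B C D X : ℝ) : ℝ :=
  X ^ 4 / (24 * A * B * C * D)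
  + X ^ 3 / (12 * A * B * C) + X ^ 3 / (12 * A * B * D)
  + X ^ 3 / (12 * A * C * D) + X ^ 3 / (12 * B * C * D)
  + A * X ^ 2 / (24 * B * C * D) + B * X ^ 2 / (24 * A * C * D)
  + C * X ^ 2 / (24 * A * B * D) + D * X ^ 2 / (24 * A * B * C)
  + X ^ 2 / (8 * A * B) + X ^ 2 / (8 * A * C) + X ^ 2 / (8 * A * D)
  + X ^ 2 / (8 * B * C) + X ^ 2 / (8 * B * D) + X ^ 2 / (8 * C * D)
  + X / (8 * A) + X / (8 * B) + X / (8 * C) + X / (8 * D)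
  + A * X / (24 * B * C) + A * X / (24 * B * D) + A * X / (24 * C * D)
  + B * X / (24 * A * C) + B * X / (24 * A * D) + B * X / (24 * C * D)
  + C * X / (24 * A * B) + C * X / (24 * A * D) + C * X / (24 * B * D)
  + D * X / (24 * A * B) + D * X / (24 * A * C) + D * X / (24 * B * C)
  + 1 / 16
  + A / (48 * B) + A / (48 * C) + A / (48 * D)
  + B / (48 * A) + B / (48 * C) + B / (48 * D)
  + C / (48 * A) + C / (48 * B) + C / (48 * D)
  + D / (48 * A) + D / (48 * B) + D / (48 * C)
  + A * B / (144 * C * D) + A * C / (144 * B * D) + A * D / (144 * B * C)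
  + B * C / (144 * A * D) + B * D / (144 * A * C) + C * D / (144 * A * B)
  - A ^ 3 / (720 * B * C * D) - B ^ 3 / (720 * A * C * D)
  - C ^ 3 / (720 * A * B * D) - D ^ 3 / (720 * A * B * C)

/-- Partial sum over `1 ≤ k ≤ ⌊R log a⌋` of the series with base `a` and one cotangent factor
`cot (π k log b / log a)`. -/
def oneCot (x R : ℝ) (a b : ℕ) : ℝ :=
  ∑ k ∈ Finset.Icc 1 ⌊R * Real.log a⌋₊,
    Real.cos (Real.pi * k * Real.log b / Real.log a) *
      Real.cos (2 * Real.pi * k * (Real.log x / Real.log a)) /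
    (k * Real.sin (Real.pi * k * Real.log b / Real.log a))

/-- Partial sum over `1 ≤ k ≤ ⌊R log a⌋` of the series with base `a` and two cotangent factors. -/
def twoCot (x R : ℝ) (a b c : ℕ) : ℝ :=
  ∑ k ∈ Finset.Icc 1 ⌊R * Real.log a⌋₊,
    Real.cos (Real.pi * k * Real.log b / Real.log a) *
      Real.cos (Real.pi * k * Real.log c / Real.log a) *
      Real.sin (2 * Real.pi * k * (Real.log x / Real.log a)) /
    (k * Real.sin (Real.pi * k * Real.log b / Real.log a) *
      Real.sin (Real.pi * k * Real.log c / Real.log a))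

/-- Partial sum over `1 ≤ k ≤ ⌊R log a⌋` of the series with base `a` and three cotangent
factors. -/
def threeCot (x R : ℝ) (a b c d : ℕ) : ℝ :=
  ∑ k ∈ Finset.Icc 1 ⌊R * Real.log a⌋₊,
    Real.cos (Real.pi * k * Real.log b / Real.log a) *
      Real.cos (Real.pi * k * Real.log c / Real.log a) *
      Real.cos (Real.pi * k * Real.log d / Real.log a) *
      Real.cos (2 * Real.pi * k * (Real.log x / Real.log a)) /
    (k * Real.sin (Real.pi * k * Real.log b / Real.log a) *
      Real.sin (Real.pi * k * Real.log c / Real.log a) *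
      Real.sin (Real.pi * k * Real.log d / Real.log a))

/-- `P` is the value of the two one-cotangent series belonging to the pair `{a, b}`, summed with
the common cutoffs `⌊R log a⌋`, `⌊R log b⌋`, as `R → ∞` along the sequence `R`. -/
def HasPairSum (R : ℕ → ℝ) (x : ℝ) (a b : ℕ) (P : ℝ) : Prop :=
  Tendsto (fun j => oneCot x (R j) a b + oneCot x (R j) b a) atTop (𝓝 P)

/-- The same for the three two-cotangent series belonging to `{a, b, c}`. -/
def HasTripleSum (R : ℕ → ℝ) (x : ℝ) (a b c : ℕ) (T : ℝ) : Prop :=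
  Tendsto (fun j => twoCot x (R j) a b c + twoCot x (R j) b a c + twoCot x (R j) c a b)
    atTop (𝓝 T)

/-- The same for the four three-cotangent series belonging to `{a, b, c, d}`. -/
def HasQuadSum (R : ℕ → ℝ) (x : ℝ) (a b c d : ℕ) (Q : ℝ) : Prop :=
  Tendsto (fun j => threeCot x (R j) a b c d + threeCot x (R j) b a c d
    + threeCot x (R j) c a b d + threeCot x (R j) d a b c) atTop (𝓝 Q)

/-- The cotangent formula for `N_{a,b,c,d}(x)`: the series converge along `R`, and the formula
holds with their values. -/
def CotFormula (a b c d : ℕ) (R : ℕ → ℝ) (x : ℝ) : Prop :=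
  ∃ Pab Pac Pad Pbc Pbd Pcd Tabc Tabd Tacd Tbcd Q : ℝ,
    HasPairSum R x a b Pab ∧ HasPairSum R x a c Pac ∧ HasPairSum R x a d Pad ∧
    HasPairSum R x b c Pbc ∧ HasPairSum R x b d Pbd ∧ HasPairSum R x c d Pcd ∧
    HasTripleSum R x a b c Tabc ∧ HasTripleSum R x a b d Tabd ∧
    HasTripleSum R x a c d Tacd ∧ HasTripleSum R x b c d Tbcd ∧
    HasQuadSum R x a b c d Q ∧
    (count a b c d x : ℝ) =
      mainPoly (Real.log a) (Real.log b) (Real.log c) (Real.log d) (Real.log x)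
      - 1 / 8 * bernoulliOneStar (Real.log x / Real.log a)
      - 1 / 8 * bernoulliOneStar (Real.log x / Real.log b)
      - 1 / 8 * bernoulliOneStar (Real.log x / Real.log c)
      - 1 / 8 * bernoulliOneStar (Real.log x / Real.log d)
      - 1 / (8 * Real.pi) * (Pab + Pac + Pad + Pbc + Pbd + Pcd)
      - 1 / (8 * Real.pi) * (Tabc + Tabd + Tacd + Tbcd)
      + 1 / (8 * Real.pi) * Q
      + 1 / 2 * chi a b c d x

end

end SmoothCount

namespace SmoothCount

/-! The proof is Perron's formula followed by a contour shift. On `Re s = 1` the Dirichlet series of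
the exponent vectors, with frequencies λ = p log a + q log b + l log c + f log d, is the product
F(s) of the factors 1 / (1 - exp(-s L_u)). Integrating exp(sX) F(s) / s over that line counts the
frequencies λ ≤ X, with weight 1/2 for λ = X (`tendsto_perron`). Unique representation turns this
weight into the term χ/2.

The line is moved to `Re s = -∞`. At heights T = 2πR where all |sin(T L_u)| stay above a fixed δ,
the horizontal edges contribute O(1/T), and `exists_good_sequence` supplies such R from the
logarithms alone, independently of x. The left edge vanishes in the limit because X ≥ 0. Only
residues remain (`rectInt_geomProd`, `tendsto_sum_poleResidue`). With n bases, the origin is a pole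
of order n + 1. Its residue is a coefficient of exp(sX) ∏ s / (1 - exp(-s L_u)), which for n = 4 is
the quartic polynomial. The other poles 2πik/L_u are simple, since no two logarithms are
commensurable. Their residues contain the factors (1 - i cot) / 2, and multiplying these out yields
the sine series and the cotangent series.

A rectangle collects the poles of all the factors up to the same height, so the argument controls
only the grouped sums with cutoffs ⌊R L_u⌋; no single cotangent series is estimated. The grouped
limits are obtained by running the same formula with one, two, three and four bases. One base gives
the sawtooth B₁*, and each further base introduces a single new grouped sum, which converges because
everything else in the identity does. -/

open Complex in
/-- The integral of `f` over the boundary of `[x₀, x₁] × [y₀, y₁]`, counterclockwise. -/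
noncomputable def rectInt (f : ℂ → ℂ) (x₀ x₁ y₀ y₁ : ℝ) : ℂ :=
  (∫ x : ℝ in x₀..x₁, f (x + y₀ * I)) - (∫ x : ℝ in x₀..x₁, f (x + y₁ * I))
    + I * (∫ y : ℝ in y₀..y₁, f (x₁ + y * I)) - I * ∫ y : ℝ in y₀..y₁, f (x₀ + y * I)

/-- The closed rectangle `[x₀, x₁] × [y₀, y₁]`. -/
def closedRect (x₀ x₁ y₀ y₁ : ℝ) : Set ℂ :=
  {s | x₀ ≤ s.re ∧ s.re ≤ x₁ ∧ y₀ ≤ s.im ∧ s.im ≤ y₁}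

/-- The open rectangle `(x₀, x₁) × (y₀, y₁)`. -/
def openRect (x₀ x₁ y₀ y₁ : ℝ) : Set ℂ :=
  {s | x₀ < s.re ∧ s.re < x₁ ∧ y₀ < s.im ∧ s.im < y₁}

/-- The boundary of the rectangle `[x₀, x₁] × [y₀, y₁]`. -/
def rectBdry (x₀ x₁ y₀ y₁ : ℝ) : Set ℂ :=
  closedRect x₀ x₁ y₀ y₁ \ openRect x₀ x₁ y₀ y₁

/-! ### Rectangle integrals and the residue theorem -/

section Rect

open Complex

variable {x₀ x₁ y₀ y₁ : ℝ}

lemma isOpen_openRect : IsOpen (openRect x₀ x₁ y₀ y₁) := by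
  have : openRect x₀ x₁ y₀ y₁ = Set.Ioo x₀ x₁ ×ℂ Set.Ioo y₀ y₁ := by
    ext s; simp [openRect, Complex.mem_reProdIm, and_assoc]
  rw [this]
  exact isOpen_Ioo.reProdIm isOpen_Ioo

lemma openRect_subset_closedRect : openRect x₀ x₁ y₀ y₁ ⊆ closedRect x₀ x₁ y₀ y₁ :=
  fun _ h => ⟨h.1.le, h.2.1.le, h.2.2.1.le, h.2.2.2.le⟩

lemma horizontal_mem_rectBdry (hy : y₀ ≤ y₁) {x y : ℝ} (h : x ∈ Set.Icc x₀ x₁)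
    (h' : y = y₀ ∨ y = y₁) : (x + y * I : ℂ) ∈ rectBdry x₀ x₁ y₀ y₁ := by
  have h1 := h.1
  have h2 := h.2
  refine ⟨?_, ?_⟩
  · rcases h' with rfl | rfl <;> simp [closedRect, *]
  · rcases h' with rfl | rfl <;> simp [openRect]

lemma vertical_mem_rectBdry (hx : x₀ ≤ x₁) {x y : ℝ} (h : y ∈ Set.Icc y₀ y₁)
    (h' : x = x₀ ∨ x = x₁) : (x + y * I : ℂ) ∈ rectBdry x₀ x₁ y₀ y₁ := by
  have h1 := h.1
  have h2 := h.2
  refine ⟨?_, ?_⟩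
  · rcases h' with rfl | rfl <;> simp [closedRect, *]
  · rcases h' with rfl | rfl <;> simp [openRect]

lemma rectInt_congr (hx : x₀ ≤ x₁) (hy : y₀ ≤ y₁) {f g : ℂ → ℂ}
    (h : Set.EqOn f g (rectBdry x₀ x₁ y₀ y₁)) :
    rectInt f x₀ x₁ y₀ y₁ = rectInt g x₀ x₁ y₀ y₁ := by
  unfold rectInt
  congr 1
  · congr 1
    · congr 1 <;>
      · refine intervalIntegral.integral_congr fun x hx' => h ?_
        rw [Set.uIcc_of_le hx] at hx'
        exact horizontal_mem_rectBdry hy hx' (by simp)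
    · congr 1
      refine intervalIntegral.integral_congr fun x hx' => h ?_
      rw [Set.uIcc_of_le hy] at hx'
      exact vertical_mem_rectBdry hx hx' (by simp)
  · congr 1
    refine intervalIntegral.integral_congr fun x hx' => h ?_
    rw [Set.uIcc_of_le hy] at hx'
    exact vertical_mem_rectBdry hx hx' (by simp)

lemma intervalIntegrable_horizontal (hx : x₀ ≤ x₁) (hy : y₀ ≤ y₁) {f : ℂ → ℂ}
    (h : ContinuousOn f (rectBdry x₀ x₁ y₀ y₁)) {y : ℝ} (h' : y = y₀ ∨ y = y₁) :
    IntervalIntegrable (fun x : ℝ => f (x + y * I)) MeasureTheory.volume x₀ x₁ := by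
  refine ContinuousOn.intervalIntegrable (h.comp (by fun_prop) fun x hx' => ?_)
  rw [Set.uIcc_of_le hx] at hx'
  exact horizontal_mem_rectBdry hy hx' h'

lemma intervalIntegrable_vertical (hx : x₀ ≤ x₁) (hy : y₀ ≤ y₁) {f : ℂ → ℂ}
    (h : ContinuousOn f (rectBdry x₀ x₁ y₀ y₁)) {x : ℝ} (h' : x = x₀ ∨ x = x₁) :
    IntervalIntegrable (fun y : ℝ => f (x + y * I)) MeasureTheory.volume y₀ y₁ := by
  refine ContinuousOn.intervalIntegrable (h.comp (by fun_prop) fun y hy' => ?_)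
  rw [Set.uIcc_of_le hy] at hy'
  exact vertical_mem_rectBdry hx hy' h'

lemma rectInt_add (hx : x₀ ≤ x₁) (hy : y₀ ≤ y₁) {f g : ℂ → ℂ}
    (hf : ContinuousOn f (rectBdry x₀ x₁ y₀ y₁)) (hg : ContinuousOn g (rectBdry x₀ x₁ y₀ y₁)) :
    rectInt (fun s => f s + g s) x₀ x₁ y₀ y₁ = rectInt f x₀ x₁ y₀ y₁ + rectInt g x₀ x₁ y₀ y₁ := by
  unfold rectInt
  rw [intervalIntegral.integral_add (intervalIntegrable_horizontal hx hy hf (.inl rfl))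
      (intervalIntegrable_horizontal hx hy hg (.inl rfl)),
    intervalIntegral.integral_add (intervalIntegrable_horizontal hx hy hf (.inr rfl))
      (intervalIntegrable_horizontal hx hy hg (.inr rfl)),
    intervalIntegral.integral_add (intervalIntegrable_vertical hx hy hf (.inl rfl))
      (intervalIntegrable_vertical hx hy hg (.inl rfl)),
    intervalIntegral.integral_add (intervalIntegrable_vertical hx hy hf (.inr rfl))
      (intervalIntegrable_vertical hx hy hg (.inr rfl))]
  ring

lemma rectInt_const_mul (c : ℂ) (f : ℂ → ℂ) :
    rectInt (fun s => c * f s) x₀ x₁ y₀ y₁ = c * rectInt f x₀ x₁ y₀ y₁ := by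
  simp only [rectInt, intervalIntegral.integral_const_mul]
  ring

/-- Cauchy's theorem for a rectangle. -/
lemma rectInt_eq_zero (hx : x₀ ≤ x₁) (hy : y₀ ≤ y₁) {f : ℂ → ℂ}
    (hf : ∀ s ∈ closedRect x₀ x₁ y₀ y₁, DifferentiableAt ℂ f s) :
    rectInt f x₀ x₁ y₀ y₁ = 0 := by
  have := Complex.integral_boundary_rect_eq_zero_of_differentiableOn f (x₀ + y₀ * I) (x₁ + y₁ * I)
    (fun s hs => (hf s (by
      simpa [Complex.mem_reProdIm, Set.uIcc_of_le hx, Set.uIcc_of_le hy, closedRect,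
        and_assoc] using hs)).differentiableWithinAt)
  simpa [rectInt] using this

lemma integral_horizontal_of_hasDerivAt {F f : ℂ → ℂ} {a b y : ℝ} (hab : a ≤ b)
    (h : ∀ x ∈ Set.Icc a b, HasDerivAt F (f (x + y * I)) (x + y * I : ℂ))
    (hc : ContinuousOn (fun x : ℝ => f (x + y * I)) (Set.Icc a b)) :
    ∫ x : ℝ in a..b, f (x + y * I) = F (b + y * I) - F (a + y * I) := by
  rw [← Set.uIcc_of_le hab] at h hc
  refine intervalIntegral.integral_eq_sub_of_hasDerivAt
    (f := fun x : ℝ => F (x + y * I)) (fun x hx => ?_) hc.intervalIntegrable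
  have h1 : HasDerivAt (fun x : ℝ => (x + y * I : ℂ)) 1 x :=
    (Complex.ofRealCLM.hasDerivAt (x := x)).add_const _
  exact ((h x hx).comp x h1).congr_deriv (mul_one _)

lemma integral_vertical_of_hasDerivAt {F f : ℂ → ℂ} {a b x : ℝ} (hab : a ≤ b)
    (h : ∀ y ∈ Set.Icc a b, HasDerivAt F (f (x + y * I)) (x + y * I : ℂ))
    (hc : ContinuousOn (fun y : ℝ => f (x + y * I)) (Set.Icc a b)) :
    I * ∫ y : ℝ in a..b, f (x + y * I) = F (x + b * I) - F (x + a * I) := by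
  rw [← Set.uIcc_of_le hab] at h hc
  rw [← intervalIntegral.integral_const_mul]
  refine intervalIntegral.integral_eq_sub_of_hasDerivAt
    (f := fun y : ℝ => F (x + y * I)) (fun y hy => ?_)
    (continuousOn_const.mul hc).intervalIntegrable
  have h1 : HasDerivAt (fun y : ℝ => (x + y * I : ℂ)) I y := by
    simpa using ((Complex.ofRealCLM.hasDerivAt (x := y)).mul_const I).const_add (x : ℂ)
  exact ((h y hy).comp y h1).congr_deriv (mul_comm _ _)

lemma rectInt_of_hasDerivAt (hx : x₀ ≤ x₁) (hy : y₀ ≤ y₁) {F f : ℂ → ℂ}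
    (hF : ∀ s ∈ rectBdry x₀ x₁ y₀ y₁, HasDerivAt F (f s) s)
    (hf : ContinuousOn f (rectBdry x₀ x₁ y₀ y₁)) : rectInt f x₀ x₁ y₀ y₁ = 0 := by
  have H : ∀ y, (y = y₀ ∨ y = y₁) →
      ∫ x : ℝ in x₀..x₁, f (x + y * I) = F (x₁ + y * I) - F (x₀ + y * I) := fun y h' =>
    integral_horizontal_of_hasDerivAt hx
      (fun x h => hF _ (horizontal_mem_rectBdry hy h h'))
      (hf.comp (by fun_prop) fun x h => horizontal_mem_rectBdry hy h h')
  have V : ∀ x, (x = x₀ ∨ x = x₁) →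
      I * ∫ y : ℝ in y₀..y₁, f (x + y * I) = F (x + y₁ * I) - F (x + y₀ * I) := fun x h' =>
    integral_vertical_of_hasDerivAt hy
      (fun y h => hF _ (vertical_mem_rectBdry hx h h'))
      (hf.comp (by fun_prop) fun y h => vertical_mem_rectBdry hx h h')
  rw [rectInt, H _ (.inl rfl), H _ (.inr rfl), V _ (.inl rfl), V _ (.inr rfl)]
  ring

lemma log_sub_log_neg_of_im_pos {z : ℂ} (hz : 0 < z.im) :
    Complex.log z - Complex.log (-z) = Real.pi * I := by
  rw [Complex.log, Complex.log, norm_neg, Complex.arg_neg_eq_arg_sub_pi_of_im_pos hz]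
  push_cast; ring

lemma log_sub_log_neg_of_im_neg {z : ℂ} (hz : z.im < 0) :
    Complex.log z - Complex.log (-z) = -(Real.pi * I) := by
  rw [Complex.log, Complex.log, norm_neg, Complex.arg_neg_eq_arg_add_pi_of_im_neg hz]
  push_cast; ring

lemma sub_ne_zero_of_mem_rectBdry {ρ s : ℂ} (hρ : ρ ∈ openRect x₀ x₁ y₀ y₁)
    (hs : s ∈ rectBdry x₀ x₁ y₀ y₁) : s - ρ ≠ 0 :=
  sub_ne_zero.2 fun h => hs.2 (h ▸ hρ)

lemma continuousOn_inv_sub_pow {ρ : ℂ} (hρ : ρ ∈ openRect x₀ x₁ y₀ y₁) (n : ℕ) :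
    ContinuousOn (fun s => ((s - ρ) ^ n)⁻¹) (rectBdry x₀ x₁ y₀ y₁) :=
  ContinuousOn.inv₀ (by fun_prop) fun _ hs => pow_ne_zero _ (sub_ne_zero_of_mem_rectBdry hρ hs)

lemma continuousOn_inv_sub {ρ : ℂ} (hρ : ρ ∈ openRect x₀ x₁ y₀ y₁) :
    ContinuousOn (fun s => (s - ρ)⁻¹) (rectBdry x₀ x₁ y₀ y₁) := by
  simpa using continuousOn_inv_sub_pow hρ 1

/-- log(s - ρ) is a primitive on the bottom, right and top edges. The left edge crosses its cut, so
log(-(s - ρ)) is used there. The two branches differ by ±πi at the two left corners, and these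
mismatches add up to 2πi. -/
lemma rectInt_inv_sub {ρ : ℂ} (hρ : ρ ∈ openRect x₀ x₁ y₀ y₁) :
    rectInt (fun s => (s - ρ)⁻¹) x₀ x₁ y₀ y₁ = 2 * Real.pi * I := by
  obtain ⟨h1, h2, h3, h4⟩ := id hρ
  have hx : x₀ ≤ x₁ := (h1.trans h2).le
  have hy : y₀ ≤ y₁ := (h3.trans h4).le
  have hc := continuousOn_inv_sub hρ
  have D : ∀ s, s - ρ ∈ Complex.slitPlane →
      HasDerivAt (fun s => Complex.log (s - ρ)) ((s - ρ)⁻¹) s := fun s hs => by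
    simpa using ((hasDerivAt_id s).sub_const ρ).clog hs
  have D' : ∀ s, -(s - ρ) ∈ Complex.slitPlane →
      HasDerivAt (fun s => Complex.log (-(s - ρ))) ((s - ρ)⁻¹) s := fun s hs => by
    refine (((hasDerivAt_id s).sub_const ρ).neg.clog hs).congr_deriv ?_
    change -1 / -(s - ρ) = (s - ρ)⁻¹
    rw [neg_div_neg_eq, one_div]
  have H : ∀ y, (y = y₀ ∨ y = y₁) →
      ∫ x : ℝ in x₀..x₁, ((x + y * I : ℂ) - ρ)⁻¹ =
        Complex.log (x₁ + y * I - ρ) - Complex.log (x₀ + y * I - ρ) := fun y h' => by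
    refine integral_horizontal_of_hasDerivAt hx (f := fun s => (s - ρ)⁻¹)
      (F := fun s => Complex.log (s - ρ))
      (fun x h => D _ ?_)
      (hc.comp (by fun_prop) fun x h => horizontal_mem_rectBdry hy h h')
    right
    rcases h' with rfl | rfl <;> simp <;> intro h <;> linarith
  have V1 : I * ∫ y : ℝ in y₀..y₁, ((x₁ + y * I : ℂ) - ρ)⁻¹ =
        Complex.log (x₁ + y₁ * I - ρ) - Complex.log (x₁ + y₀ * I - ρ) := by
    refine integral_vertical_of_hasDerivAt hy (f := fun s => (s - ρ)⁻¹)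
      (F := fun s => Complex.log (s - ρ))
      (fun x h => D _ ?_)
      (hc.comp (by fun_prop) fun y h => vertical_mem_rectBdry hx h (.inr rfl))
    left
    simp; linarith
  have V0 : I * ∫ y : ℝ in y₀..y₁, ((x₀ + y * I : ℂ) - ρ)⁻¹ =
        Complex.log (-(x₀ + y₁ * I - ρ)) - Complex.log (-(x₀ + y₀ * I - ρ)) := by
    refine integral_vertical_of_hasDerivAt hy (f := fun s => (s - ρ)⁻¹)
      (F := fun s => Complex.log (-(s - ρ)))
      (fun x h => D' _ ?_)
      (hc.comp (by fun_prop) fun y h => vertical_mem_rectBdry hx h (.inl rfl))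
    left
    simp; linarith
  rw [rectInt, H _ (.inl rfl), H _ (.inr rfl), V0, V1]
  have e1 := log_sub_log_neg_of_im_pos (z := x₀ + y₁ * I - ρ) (by simp; linarith)
  have e2 := log_sub_log_neg_of_im_neg (z := x₀ + y₀ * I - ρ) (by simp; linarith)
  linear_combination e1 - e2

lemma rectInt_inv_sub_pow {ρ : ℂ} (hρ : ρ ∈ openRect x₀ x₁ y₀ y₁) (n : ℕ) :
    rectInt (fun s => ((s - ρ) ^ (n + 2))⁻¹) x₀ x₁ y₀ y₁ = 0 := by
  obtain ⟨h1, h2, h3, h4⟩ := id hρ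
  refine rectInt_of_hasDerivAt (h1.trans h2).le (h3.trans h4).le
    (F := fun s => -((n + 1 : ℂ))⁻¹ * ((s - ρ) ^ (n + 1))⁻¹) (fun s hs => ?_)
    (continuousOn_inv_sub_pow hρ _)
  have h0 := sub_ne_zero_of_mem_rectBdry hρ hs
  have hn : (n + 1 : ℂ) ≠ 0 := by exact_mod_cast n.succ_ne_zero
  have := (((((hasDerivAt_id s).sub_const ρ).pow (n + 1)).inv (pow_ne_zero _ h0)).const_mul
    (-((n + 1 : ℂ))⁻¹))
  refine this.congr_deriv ?_
  simp only [id, Nat.add_sub_cancel, mul_one, Pi.pow_apply]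
  push_cast
  field_simp
  ring

/-- The residue theorem for a rectangle and finitely many simple poles. -/
theorem rectInt_eq_sum_residues (hx : x₀ ≤ x₁) (hy : y₀ ≤ y₁) {κ : Type*} (J : Finset κ)
    (ρ r : κ → ℂ) :
    ∀ f : ℂ → ℂ, Set.InjOn ρ J → (∀ i ∈ J, ρ i ∈ openRect x₀ x₁ y₀ y₁) →
    (∀ s ∈ closedRect x₀ x₁ y₀ y₁, s ∉ ρ '' J → DifferentiableAt ℂ f s) →
    (∀ i ∈ J, Tendsto (fun s => (s - ρ i) * f s) (𝓝[≠] ρ i) (𝓝 (r i))) →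
    rectInt f x₀ x₁ y₀ y₁ = 2 * Real.pi * I * ∑ i ∈ J, r i := by
  classical
  induction J using Finset.induction_on with
  | empty =>
    intro f _ _ hf _
    simpa using rectInt_eq_zero hx hy fun s hs => hf s hs (by simp)
  | insert i J hi ih =>
    intro f hinj hmem hf hr
    have hne : ∀ j ∈ J, ρ j ≠ ρ i := fun j hj h =>
      hi (hinj (by simp [hj]) (by simp) h ▸ hj)
    have hiR := hmem i (by simp)
    set g : ℂ → ℂ := fun s => f s - r i * (s - ρ i)⁻¹ with hg
    have hgd : ∀ s ∈ closedRect x₀ x₁ y₀ y₁, s ∉ ρ '' (insert i J : Finset κ) →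
        DifferentiableAt ℂ g s := fun s hs hs' => by
      have : s - ρ i ≠ 0 := sub_ne_zero.2 fun h => hs' ⟨i, by simp, h.symm⟩
      exact (hf s hs hs').sub (((differentiableAt_id.sub_const (ρ i)).fun_inv this).const_mul _)
    have hnear : ∀ᶠ s in 𝓝[≠] ρ i, s ∈ closedRect x₀ x₁ y₀ y₁ ∧
        s ∉ ρ '' (insert i J : Finset κ) := by
      have e1 : ∀ᶠ s in 𝓝 (ρ i), s ∈ openRect x₀ x₁ y₀ y₁ := isOpen_openRect.mem_nhds hiR
      have e2 : ∀ᶠ s in 𝓝 (ρ i), s ∉ ρ '' (J : Set κ) :=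
        ((J.finite_toSet.image ρ).isClosed.isOpen_compl).mem_nhds (by
          rintro ⟨j, hj, h⟩; exact hne j hj h)
      filter_upwards [nhdsWithin_le_nhds e1, nhdsWithin_le_nhds e2, self_mem_nhdsWithin]
        with s h1 h2 h3
      refine ⟨openRect_subset_closedRect h1, ?_⟩
      rw [Finset.coe_insert, Set.image_insert_eq, Set.mem_insert_iff, not_or]
      exact ⟨h3, h2⟩
    have hgt : Tendsto (fun s => (s - ρ i) * g s) (𝓝[≠] ρ i) (𝓝 0) := by
      have := (hr i (by simp)).sub_const (r i)
      rw [sub_self] at this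
      refine this.congr' ?_
      filter_upwards [self_mem_nhdsWithin] with s hs
      have : s - ρ i ≠ 0 := sub_ne_zero.2 hs
      simp only [hg]; field_simp
    -- Once the polar part at ρ i is subtracted, g is o(1 / (s - ρ i)) there, so the singularity is
    -- removable. G is the filled-in function, and the induction hypothesis applies to it with the
    -- remaining poles.
    set G : ℂ → ℂ := Function.update g (ρ i) (limUnder (𝓝[≠] ρ i) g) with hG
    have hGg : ∀ s, s ≠ ρ i → G s = g s := fun s hs => by simp [hG, hs]
    have hGi : DifferentiableAt ℂ G (ρ i) := by
      obtain ⟨V, hV, hVo, hVi⟩ := mem_nhdsWithin.1 hnear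
      have hd : DifferentiableOn ℂ g (V \ {ρ i}) := fun s hs =>
        (hgd s (hVi ⟨hs.1, hs.2⟩).1 (hVi ⟨hs.1, hs.2⟩).2).differentiableWithinAt
      have ho : (fun z => g z - g (ρ i)) =o[𝓝[≠] ρ i] fun z => (z - ρ i)⁻¹ := by
        rw [Asymptotics.isLittleO_iff_tendsto']
        · have h0 : Tendsto (fun s => (s - ρ i) * g (ρ i)) (𝓝[≠] ρ i) (𝓝 0) := by
            have : Tendsto (fun s => (s - ρ i) * g (ρ i)) (𝓝 (ρ i)) (𝓝 ((ρ i - ρ i) * g (ρ i))) :=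
              Continuous.tendsto (by fun_prop) _
            simpa using this.mono_left nhdsWithin_le_nhds
          have := hgt.sub h0
          simp only [sub_zero] at this
          refine this.congr fun s => ?_
          rw [div_inv_eq_mul]; ring
        · filter_upwards [self_mem_nhdsWithin] with s hs h
          exact absurd (inv_eq_zero.1 h) (sub_ne_zero.2 hs)
      exact (Complex.differentiableOn_update_limUnder_of_isLittleO (hV.mem_nhds hVo) hd
        ho).differentiableAt (hV.mem_nhds hVo)
    have key := ih G (hinj.mono (by simp)) (fun j hj => hmem j (by simp [hj])) ?_ ?_
    · rw [Finset.sum_insert hi, mul_add, ← key]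
      have hfd : ContinuousOn f (rectBdry x₀ x₁ y₀ y₁) := fun s hs =>
        (hf s hs.1 (by
          rintro ⟨j, hj, rfl⟩
          exact hs.2 (hmem j hj))).continuousAt.continuousWithinAt
      have hie : ContinuousOn (fun s => r i * (s - ρ i)⁻¹) (rectBdry x₀ x₁ y₀ y₁) :=
        continuousOn_const.mul (continuousOn_inv_sub hiR)
      have e1 : rectInt f x₀ x₁ y₀ y₁ =
          rectInt (fun s => g s + r i * (s - ρ i)⁻¹) x₀ x₁ y₀ y₁ :=
        rectInt_congr hx hy fun s _ => by simp [hg]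
      have hgc : ContinuousOn g (rectBdry x₀ x₁ y₀ y₁) := hfd.sub hie
      rw [e1, rectInt_add hx hy hgc hie, rectInt_const_mul, rectInt_inv_sub hiR,
        rectInt_congr hx hy (f := g) (g := G) fun s hs =>
          (hGg s (sub_ne_zero.1 (sub_ne_zero_of_mem_rectBdry hiR hs))).symm]
      ring
    · intro s hs hs'
      by_cases h : s = ρ i
      · rw [h]; exact hGi
      · have h1 : DifferentiableAt ℂ g s := hgd s hs (by
          rw [Finset.coe_insert, Set.image_insert_eq, Set.mem_insert_iff, not_or]
          exact ⟨h, hs'⟩)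
        refine h1.congr_of_eventuallyEq ?_
        filter_upwards [isOpen_ne.mem_nhds h] with z hz using hGg z hz
    · intro j hj
      have h0 : Tendsto (fun s => (s - ρ j) * (r i * (s - ρ i)⁻¹)) (𝓝[≠] ρ j) (𝓝 0) := by
        have hc : ContinuousAt (fun s => (s - ρ j) * (r i * (s - ρ i)⁻¹)) (ρ j) := by
          have := sub_ne_zero.2 (hne j hj)
          fun_prop (disch := assumption)
        simpa using hc.tendsto.mono_left nhdsWithin_le_nhds
      have := (hr j (by simp [hj])).sub h0
      rw [sub_zero] at this
      refine this.congr' ?_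
      filter_upwards [nhdsWithin_le_nhds (isOpen_ne.mem_nhds (hne j hj))] with z hz
      rw [hGg z hz]; simp only [hg]; ring

end Rect

/-! ### Perron's formula -/

section Perron

open Complex

/-- Comparison of the integral over a vertical segment on the line `Re s = 1` with the limit of
the integrals over the rectangles to the left of it. -/
lemma norm_integral_vertical_sub_le {f : ℂ → ℂ} {T B C : ℝ} {S : ℂ} {ε : ℝ → ℝ} (hT : 0 < T)
    (hB : 0 < B) (htop : ∀ σ : ℝ, σ ≤ 1 → ‖f (σ + T * I)‖ ≤ C * Real.exp (B * σ))
    (hbot : ∀ σ : ℝ, σ ≤ 1 → ‖f (σ + (-T : ℝ) * I)‖ ≤ C * Real.exp (B * σ))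
    (hleft : ∀ᶠ K : ℝ in atTop, ∀ y ∈ Set.Icc (-T) T, ‖f ((-K : ℝ) + y * I)‖ ≤ ε K)
    (hε : Tendsto ε atTop (𝓝 0))
    (hf : ∀ᶠ K : ℝ in atTop, rectInt f (-K) 1 (-T) T = 2 * Real.pi * I * S) :
    ‖(∫ y : ℝ in (-T)..T, f ((1 : ℝ) + y * I)) - 2 * Real.pi * S‖ ≤
      2 * (C * Real.exp B / B) := by
  have hC : 0 ≤ C := by
    have := (norm_nonneg _).trans (htop 0 zero_le_one)
    simpa using this
  have hexp : ∀ K : ℝ, ∫ σ in (-K)..1, C * Real.exp (B * σ) ≤ C * Real.exp B / B := fun K => by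
    rw [intervalIntegral.integral_const_mul,
      intervalIntegral.integral_comp_mul_left (fun x => Real.exp x) hB.ne', integral_exp,
      smul_eq_mul, mul_one, mul_div_assoc, inv_mul_eq_div]
    gcongr
    linarith [Real.exp_pos (B * -K)]
  have key : ∀ᶠ K : ℝ in atTop,
      ‖(∫ y : ℝ in (-T)..T, f ((1 : ℝ) + y * I)) - 2 * Real.pi * S‖ ≤
        2 * (C * Real.exp B / B) + ε K * (2 * T) := by
    filter_upwards [hleft, hf, eventually_ge_atTop 0] with K h1 h2 h3
    have hK : -K ≤ 1 := by linarith
    have b1 : ‖∫ x : ℝ in (-K)..1, f (x + (-T : ℝ) * I)‖ ≤ C * Real.exp B / B :=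
      (intervalIntegral.norm_integral_le_of_norm_le hK
        (.of_forall fun x hx => hbot x hx.2)
        (Continuous.intervalIntegrable (by fun_prop) _ _)).trans (hexp K)
    have b2 : ‖∫ x : ℝ in (-K)..1, f (x + T * I)‖ ≤ C * Real.exp B / B :=
      (intervalIntegral.norm_integral_le_of_norm_le hK
        (.of_forall fun x hx => htop x hx.2)
        (Continuous.intervalIntegrable (by fun_prop) _ _)).trans (hexp K)
    have b3 : ‖∫ y : ℝ in (-T)..T, f ((-K : ℝ) + y * I)‖ ≤ ε K * (2 * T) := by
      refine (intervalIntegral.norm_integral_le_of_norm_le_const (C := ε K)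
        fun y hy => ?_).trans_eq ?_
      · rw [Set.uIoc_of_le (by linarith)] at hy
        exact h1 y ⟨hy.1.le, hy.2⟩
      · rw [sub_neg_eq_add, abs_of_pos (by linarith)]; ring
    rw [rectInt] at h2
    set R := ∫ y : ℝ in (-T)..T, f ((1 : ℝ) + y * I)
    have e : R - 2 * Real.pi * S = I * ((∫ x : ℝ in (-K)..1, f (x + (-T : ℝ) * I))
        - ∫ x : ℝ in (-K)..1, f (x + T * I)) + ∫ y : ℝ in (-T)..T, f ((-K : ℝ) + y * I) := by
      linear_combination (-I) * h2 + (R - 2 * Real.pi * S -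
        ∫ y : ℝ in (-T)..T, f ((-K : ℝ) + y * I)) * I_mul_I
    rw [e]
    refine (norm_add_le _ _).trans (add_le_add ?_ b3)
    rw [norm_mul, norm_I, one_mul]
    exact (norm_sub_le _ _).trans (by linarith)
  -- The left-hand side does not depend on K, so K may tend to infinity, which removes the
  -- contribution of the left edge.
  refine ge_of_tendsto (f := fun K => 2 * (C * Real.exp B / B) + ε K * (2 * T)) ?_ key
  simpa using (hε.mul_const (2 * T)).const_add (2 * (C * Real.exp B / B))

/-- The truncated Perron kernel. -/
noncomputable def perronKernel (T Y : ℝ) : ℂ :=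
  ∫ y : ℝ in (-T)..T, Complex.exp (((1 : ℝ) + y * I) * Y) / ((1 : ℝ) + y * I)

/-- The step function with value `1 / 2` at the jump. -/
noncomputable def perronStep (Y : ℝ) : ℝ := if Y < 0 then 0 else if Y = 0 then 1 / 2 else 1

lemma abs_le_norm_add_mul_I (σ y : ℝ) : |y| ≤ ‖(σ + y * I : ℂ)‖ := by
  simpa using Complex.abs_im_le_norm (σ + y * I : ℂ)

lemma abs_le_norm_add_mul_I' (σ y : ℝ) : |σ| ≤ ‖(σ + y * I : ℂ)‖ := by
  simpa using Complex.abs_re_le_norm (σ + y * I : ℂ)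

lemma norm_exp_mul_ofReal (s : ℂ) (Y : ℝ) : ‖Complex.exp (s * Y)‖ = Real.exp (s.re * Y) := by
  rw [Complex.norm_exp]; simp

/-- The factor 1/K alone gives the decay, so Y = 0 is allowed; this covers x = 1. -/
lemma tendsto_inv_mul_exp_neg {Y : ℝ} (hY : 0 ≤ Y) (c : ℝ) :
    Tendsto (fun K : ℝ => c * Real.exp (-K * Y) / K) atTop (𝓝 0) := by
  have h1 : Tendsto (fun K : ℝ => |c| * K⁻¹) atTop (𝓝 0) := by
    simpa using tendsto_inv_atTop_zero.const_mul |c|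
  refine squeeze_zero_norm' ?_ h1
  filter_upwards [eventually_gt_atTop 0] with K hK
  rw [norm_div, norm_mul, Real.norm_eq_abs, Real.norm_eq_abs, Real.abs_exp, Real.norm_eq_abs,
    abs_of_pos hK, div_eq_mul_inv]
  gcongr
  have : Real.exp (-K * Y) ≤ 1 := Real.exp_le_one_iff.2 (by nlinarith)
  nlinarith [abs_nonneg c]

lemma norm_perronKernel_sub_le_of_pos {T Y : ℝ} (hT : 0 < T) (hY : 0 < Y) :
    ‖perronKernel T Y - 2 * Real.pi‖ ≤ 2 * (T⁻¹ * Real.exp Y / Y) := by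
  have hb : ∀ σ t : ℝ, |t| = T →
      ‖Complex.exp ((σ + t * I) * Y) / (σ + t * I)‖ ≤ T⁻¹ * Real.exp (Y * σ) := fun σ t ht => by
    have := abs_le_norm_add_mul_I σ t
    rw [norm_div, norm_exp_mul_ofReal, div_eq_inv_mul]
    simp only [add_re, ofReal_re, mul_re, I_re, mul_zero, ofReal_im, I_im, mul_one, sub_self,
      add_zero]
    rw [mul_comm σ Y]
    gcongr
    rwa [ht] at this
  have := norm_integral_vertical_sub_le (f := fun s => Complex.exp (s * Y) / s) (T := T) (B := Y)
    (C := T⁻¹) (S := 1) (ε := fun K => 1 * Real.exp (-K * Y) / K) hT hY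
    (fun σ _ => hb σ T (abs_of_pos hT)) (fun σ _ => hb σ (-T) (by rw [abs_neg, abs_of_pos hT]))
    ?_ (tendsto_inv_mul_exp_neg hY.le 1) ?_
  · simpa [perronKernel] using this
  · filter_upwards [eventually_gt_atTop 0] with K hK y hy
    have := abs_le_norm_add_mul_I' (-K) y
    rw [abs_neg, abs_of_pos hK] at this
    rw [norm_div, norm_exp_mul_ofReal]
    simp only [add_re, ofReal_re, mul_re, I_re, mul_zero, ofReal_im, I_im, mul_one, sub_self,
      add_zero, one_mul]
    gcongr
  · filter_upwards [eventually_gt_atTop 0] with K hK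
    have := rectInt_eq_sum_residues (x₀ := -K) (x₁ := 1) (y₀ := -T) (y₁ := T) (by linarith)
      (by linarith) (κ := Unit) {()} (fun _ => 0) (fun _ => 1) (fun s => Complex.exp (s * Y) / s)
      (by simp) (by simp [openRect, hK, hT]) ?_ ?_
    · simpa using this
    · intro s _ hs
      have : s ≠ 0 := by simpa using hs
      fun_prop (disch := assumption)
    · intro i _
      have hc : Continuous fun s : ℂ => Complex.exp (s * Y) := by fun_prop
      have := (hc.tendsto 0).mono_left (nhdsWithin_le_nhds (s := {0}ᶜ))
      simp only [zero_mul, Complex.exp_zero] at this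
      refine this.congr' ?_
      filter_upwards [self_mem_nhdsWithin] with s hs
      have : s ≠ 0 := hs
      field_simp
      simp

/-- For Y < 0 the contour has to move to the right. The reflection s ↦ 2 - s preserves the line `Re
s = 1` and reduces this to a shift to the left. The pole then sits at 2, outside the rectangles, so
no residue appears. -/
lemma norm_perronKernel_le_of_neg {T Y : ℝ} (hT : 0 < T) (hY : Y < 0) :
    ‖perronKernel T Y‖ ≤ 2 * (T⁻¹ * Real.exp Y / (-Y)) := by
  have hre : ∀ σ t : ℝ, ‖Complex.exp ((2 - (σ + t * I)) * Y) / (2 - (σ + t * I))‖ =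
      Real.exp ((2 - σ) * Y) / ‖((2 - σ : ℝ) + (-t : ℝ) * I : ℂ)‖ := fun σ t => by
    rw [norm_div, norm_exp_mul_ofReal]
    congr 2
    · simp
    · push_cast; ring
  have hb : ∀ σ t : ℝ, |t| = T →
      ‖Complex.exp ((2 - (σ + t * I)) * Y) / (2 - (σ + t * I))‖ ≤
        (T⁻¹ * Real.exp (2 * Y)) * Real.exp ((-Y) * σ) := fun σ t ht => by
    have := abs_le_norm_add_mul_I (2 - σ) (-t)
    rw [abs_neg, ht] at this
    rw [hre, div_eq_inv_mul, mul_assoc, ← Real.exp_add]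
    have e : 2 * Y + -Y * σ = (2 - σ) * Y := by ring
    rw [e]
    gcongr
  have := norm_integral_vertical_sub_le
    (f := fun s => Complex.exp ((2 - s) * Y) / (2 - s)) (T := T) (B := -Y)
    (C := T⁻¹ * Real.exp (2 * Y)) (S := 0)
    (ε := fun K => Real.exp (2 * Y) * Real.exp (-K * (-Y)) / K) hT (by linarith)
    (fun σ _ => hb σ T (abs_of_pos hT)) (fun σ _ => hb σ (-T) (by rw [abs_neg, abs_of_pos hT]))
    ?_ (tendsto_inv_mul_exp_neg (by linarith) _) ?_
  · rw [mul_assoc T⁻¹, ← Real.exp_add] at this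
    have e : 2 * Y + -Y = Y := by ring
    rw [e, mul_zero, sub_zero] at this
    refine le_trans (le_of_eq ?_) this
    have e2 := intervalIntegral.integral_comp_neg (a := -T) (b := T)
      (fun y : ℝ => Complex.exp (((1 : ℝ) + y * I) * Y) / ((1 : ℝ) + y * I))
    rw [neg_neg] at e2
    rw [perronKernel, ← e2]
    congr 1
    refine intervalIntegral.integral_congr fun y _ => ?_
    have : (2 - ((1 : ℝ) + y * I) : ℂ) = (1 : ℝ) + (-y : ℝ) * I := by push_cast; ring
    simp only [this]
  · filter_upwards [eventually_gt_atTop 0] with K hK y hy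
    have := abs_le_norm_add_mul_I' (2 - -K) (-y)
    rw [abs_of_pos (by linarith)] at this
    rw [hre, ← Real.exp_add]
    have e : 2 * Y + -K * -Y = (2 - -K) * Y := by ring
    rw [e]
    gcongr
    linarith
  · filter_upwards [eventually_gt_atTop 0] with K hK
    rw [mul_zero]
    refine rectInt_eq_zero (by linarith) (by linarith) fun s hs => ?_
    have : 2 - s ≠ 0 := fun h => by
      have h1 := hs.2.1
      have h2 := congrArg re h
      simp at h2
      linarith
    fun_prop (disch := assumption)

/-- At the jump, 1 / (1 + iy) has the primitive arctan y - (i/2) log(1 + y²). Its logarithmic part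
is even in y and cancels. The limit π is half of 2π, hence the weight 1/2. -/
lemma perronKernel_zero (T : ℝ) : perronKernel T 0 = 2 * Real.arctan T := by
  have hd : ∀ y : ℝ, HasDerivAt
      (fun y : ℝ => ((Real.arctan y : ℝ) : ℂ) - I / 2 * ((Real.log (1 + y ^ 2) : ℝ) : ℂ))
      (Complex.exp (((1 : ℝ) + y * I) * (0 : ℝ)) / ((1 : ℝ) + y * I)) y := fun y => by
    have h0 : (1 + y ^ 2 : ℝ) ≠ 0 := by positivity
    have h1 := (Real.hasDerivAt_arctan y).ofReal_comp
    have h2 : HasDerivAt (fun y : ℝ => 1 + y ^ 2) (2 * y) y := by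
      simpa using (hasDerivAt_pow 2 y).const_add 1
    have h3 := ((h2.log h0).ofReal_comp).const_mul (I / 2)
    refine (h1.sub h3).congr_deriv ?_
    have h4 : (1 + y * I : ℂ) ≠ 0 := fun h => by simpa using congrArg re h
    have h5 : (1 + y ^ 2 : ℂ) ≠ 0 := by exact_mod_cast h0
    push_cast
    rw [mul_zero, Complex.exp_zero]
    field_simp
    linear_combination (-(y : ℂ) ^ 2) * I_sq
  rw [perronKernel, intervalIntegral.integral_eq_sub_of_hasDerivAt (fun y _ => hd y)]
  · rw [Real.arctan_neg, neg_sq]; push_cast; ring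
  · refine Continuous.intervalIntegrable ?_ _ _
    refine Continuous.div (by fun_prop) (by fun_prop) fun y h => by simpa using congrArg re h

lemma tendsto_perronKernel (Y : ℝ) :
    Tendsto (fun T => perronKernel T Y) atTop (𝓝 (2 * Real.pi * perronStep Y)) := by
  have hz : ∀ c : ℝ, Tendsto (fun T : ℝ => 2 * (T⁻¹ * Real.exp Y / c)) atTop (𝓝 0) := fun c => by
    simpa using ((tendsto_inv_atTop_zero.mul_const (Real.exp Y)).div_const c).const_mul 2
  rcases lt_trichotomy Y 0 with h | rfl | h
  · simp only [perronStep, h, if_true, ofReal_zero, mul_zero]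
    exact squeeze_zero_norm' (by
      filter_upwards [eventually_gt_atTop 0] with T hT using norm_perronKernel_le_of_neg hT h)
      (hz _)
  · simp only [perronKernel_zero, perronStep, lt_irrefl, if_false, if_true]
    have h1 := (continuous_ofReal.tendsto _).comp
      (Real.tendsto_arctan_atTop.mono_right nhdsWithin_le_nhds)
    have h2 := h1.const_mul 2
    have e : (2 * Real.pi * (1 / 2 : ℝ) : ℂ) = 2 * ((Real.pi / 2 : ℝ) : ℂ) := by
      push_cast; ring
    rw [e]
    exact h2
  · simp only [perronStep, h.not_gt, h.ne', if_false, ofReal_one, mul_one]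
    rw [tendsto_iff_norm_sub_tendsto_zero]
    exact squeeze_zero' (.of_forall fun _ => norm_nonneg _) (by
      filter_upwards [eventually_gt_atTop 0] with T hT using norm_perronKernel_sub_le_of_pos hT h)
      (hz _)

lemma perronStep_nonneg (Y : ℝ) : 0 ≤ perronStep Y := by
  unfold perronStep; split_ifs <;> norm_num

lemma perronStep_le_one (Y : ℝ) : perronStep Y ≤ 1 := by
  unfold perronStep; split_ifs <;> norm_num

/-- Perron's formula for the general Dirichlet series `∑ exp (-s λ)`. -/
theorem tendsto_perron {κ : Type*} [Countable κ] {lam : κ → ℝ} {F : ℂ → ℂ}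
    (hs : Summable fun i => Real.exp (-lam i))
    (hF : ∀ y : ℝ, HasSum (fun i => Complex.exp (-(((1 : ℝ) + y * I) * lam i)))
      (F ((1 : ℝ) + y * I))) (X : ℝ) :
    Tendsto (fun T : ℝ => ∫ y : ℝ in (-T)..T,
      Complex.exp (((1 : ℝ) + y * I) * X) * F ((1 : ℝ) + y * I) / ((1 : ℝ) + y * I)) atTop
      (𝓝 (2 * Real.pi * ((∑' i, perronStep (X - lam i) : ℝ) : ℂ))) := by
  have hsX : Summable fun i => Real.exp (X - lam i) := by
    simpa [sub_eq_add_neg, Real.exp_add] using hs.mul_left (Real.exp X)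
  have hsum : ∀ T : ℝ, ∫ y : ℝ in (-T)..T,
      Complex.exp (((1 : ℝ) + y * I) * X) * F ((1 : ℝ) + y * I) / ((1 : ℝ) + y * I) =
      ∑' i, perronKernel T (X - lam i) := fun T => by
    refine ((intervalIntegral.hasSum_integral_of_dominated_convergence
      (fun i _ => Real.exp (X - lam i)) (fun i => ?_) (fun i => ?_) (.of_forall fun _ _ => hsX)
      intervalIntegrable_const (.of_forall fun y _ => ?_)).tsum_eq).symm
    · refine Continuous.aestronglyMeasurable ?_
      refine Continuous.div (by fun_prop) (by fun_prop) fun y h => by simpa using congrArg re h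
    · refine .of_forall fun y _ => ?_
      rw [norm_div, norm_exp_mul_ofReal]
      have := abs_le_norm_add_mul_I' 1 y
      rw [abs_one] at this
      simpa using div_le_self (Real.exp_pos (X - lam i)).le this
    · have := ((hF y).mul_left (Complex.exp (((1 : ℝ) + y * I) * X))).div_const ((1 : ℝ) + y * I)
      refine this.congr_fun ?_
      intro i
      rw [← Complex.exp_add]
      congr 2
      push_cast; ring
  simp only [hsum]
  have hfin : {i | -1 < X - lam i}.Finite := by
    have := hsX.tendsto_cofinite_zero.eventually (gt_mem_nhds (Real.exp_pos (-1)))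
    rw [eventually_cofinite] at this
    refine this.subset fun i hi => ?_
    simpa using (le_of_lt hi : -1 ≤ X - lam i)
  have hlim : Tendsto (fun T : ℝ => ∑' i, perronKernel T (X - lam i)) atTop
      (𝓝 (∑' i, (2 * Real.pi * perronStep (X - lam i) : ℂ))) := by
    classical
    -- For Y = X - λ ≤ -1 and T ≥ 1 the kernel is at most 2 exp Y, which is summable. Only finitely
    -- many terms have Y > -1. Each of their kernels converges to a limit of norm at most 2π, so it
    -- is eventually below 2π + 1.
    refine tendsto_tsum_of_dominated_convergence
      (bound := fun i => 2 * Real.exp (X - lam i) + if -1 < X - lam i then 2 * Real.pi + 1 else 0)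
      ?_ (fun i => tendsto_perronKernel _) ?_
    · refine (hsX.mul_left 2).add (summable_of_hasFiniteSupport (hfin.subset fun i hi => ?_))
      by_contra h
      exact hi (if_neg h)
    · have h1 : ∀ᶠ T : ℝ in atTop, ∀ i ∈ {i | -1 < X - lam i},
          ‖perronKernel T (X - lam i)‖ < 2 * Real.pi + 1 := by
        refine (eventually_all_finite hfin).2 fun i _ => ?_
        refine (tendsto_perronKernel (X - lam i)).norm.eventually (gt_mem_nhds ?_)
        rw [norm_mul, norm_mul, norm_real, norm_real, Real.norm_of_nonneg (perronStep_nonneg _),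
          Real.norm_of_nonneg Real.pi_pos.le]
        have := perronStep_le_one (X - lam i)
        have := Real.pi_pos
        simp
        nlinarith
      filter_upwards [h1, eventually_ge_atTop 1] with T h1 hT i
      split_ifs with h
      · exact (h1 i h).le.trans (by linarith [Real.exp_pos (X - lam i)])
      · rw [add_zero]
        push Not at h
        refine (norm_perronKernel_le_of_neg (by linarith) (by linarith)).trans ?_
        have h3 : T⁻¹ ≤ 1 := inv_le_one_of_one_le₀ hT
        have h4 : 0 < T⁻¹ := by positivity
        gcongr
        rw [div_le_iff₀ (by linarith)]
        nlinarith [Real.exp_pos (X - lam i)]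
  convert hlim using 2
  rw [tsum_mul_left, ofReal_tsum]

end Perron

/-! ### Cutoffs avoiding the poles -/

/-- Induction on the list, for windows of arbitrary length ℓ: the new L is handled by passing to a
third of a short window, and that third is again a window for the remaining list. -/
lemma exists_forall_le_abs_sub_int (Ls : List ℝ) (hLs : ∀ L ∈ Ls, 0 < L) :
    ∀ ℓ : ℝ, 0 < ℓ → ∃ δ : ℝ, 0 < δ ∧ ∀ y : ℝ, ∃ R ∈ Set.Icc y (y + ℓ),
      ∀ L ∈ Ls, ∀ m : ℤ, δ ≤ |2 * R * L - m| := by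
  induction Ls with
  | nil => exact fun ℓ hℓ => ⟨1, one_pos, fun y => ⟨y, ⟨le_rfl, by linarith⟩, by simp⟩⟩
  | cons L Ls ih =>
    intro ℓ hℓ
    have hL : 0 < L := hLs L (by simp)
    obtain ⟨w, hw, hwℓ, hwL⟩ : ∃ w : ℝ, 0 < w ∧ w ≤ ℓ ∧ 4 * (L * w) ≤ 1 := by
      refine ⟨min ℓ (1 / (4 * L)), by positivity, min_le_left _ _, ?_⟩
      have := min_le_right ℓ (1 / (4 * L))
      rw [le_div_iff₀ (by positivity)] at this
      linarith
    obtain ⟨δ, hδ, h⟩ := ih (fun L' h' => hLs L' (by simp [h'])) (w / 3) (by positivity)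
    -- The first and the last third of a window of length w cannot both be bad. Two bad points R₁,
    -- R₂ would satisfy 2Lw/3 ≤ 2L(R₂ - R₁) ≤ 2Lw, so with errors below Lw/3 the integer m₂ - m₁
    -- would lie strictly between 0 and 8Lw/3 ≤ 2/3.
    have third : ∀ y : ℝ, (∀ R ∈ Set.Icc y (y + w / 3), ∀ m : ℤ, L * w / 3 ≤ |2 * R * L - m|) ∨
        ∀ R ∈ Set.Icc (y + 2 * w / 3) (y + 2 * w / 3 + w / 3), ∀ m : ℤ,
          L * w / 3 ≤ |2 * R * L - m| := by
      intro y
      by_contra! hcon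
      obtain ⟨⟨R₁, hR₁, m₁, h₁⟩, R₂, hR₂, m₂, h₂⟩ := hcon
      rw [abs_lt] at h₁ h₂
      have hLw : 0 < L * w := by positivity
      have a1 : L * (R₂ - R₁) ≤ L * w := by
        apply mul_le_mul_of_nonneg_left _ hL.le; linarith [hR₁.1, hR₂.2]
      have a2 : L * (w / 3) ≤ L * (R₂ - R₁) := by
        apply mul_le_mul_of_nonneg_left _ hL.le; linarith [hR₁.2, hR₂.1]
      have b1 : ((m₂ - m₁ : ℤ) : ℝ) < 1 := by push_cast; linarith
      have b2 : (0 : ℝ) < ((m₂ - m₁ : ℤ) : ℝ) := by push_cast; linarith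
      have c1 : m₂ - m₁ < 1 := by exact_mod_cast b1
      have c2 : 0 < m₂ - m₁ := by exact_mod_cast b2
      omega
    refine ⟨min δ (L * w / 3), by positivity, fun y => ?_⟩
    rcases third y with ht | ht
    · obtain ⟨R, hR, h'⟩ := h y
      refine ⟨R, ⟨hR.1, by linarith [hR.2]⟩, ?_⟩
      rintro L' (_ | ⟨_, hL'⟩) m
      · exact (min_le_right _ _).trans (ht R hR m)
      · exact (min_le_left _ _).trans (h' L' hL' m)
    · obtain ⟨R, hR, h'⟩ := h (y + 2 * w / 3)
      refine ⟨R, ⟨by linarith [hR.1], by linarith [hR.2]⟩, ?_⟩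
      rintro L' (_ | ⟨_, hL'⟩) m
      · exact (min_le_right _ _).trans (ht R hR m)
      · exact (min_le_left _ _).trans (h' L' hL' m)

/-- Jordan's inequality |sin y| ≥ (2/π)|y| at y = π(t - m), where m is the integer nearest to t. -/
lemma le_abs_sin_pi_mul {t δ : ℝ} (h : ∀ m : ℤ, δ ≤ |t - m|) : 2 * δ ≤ |Real.sin (Real.pi * t)| := by
  have h1 := h (round t)
  have h2 := abs_sub_round t
  have hpi := Real.pi_pos
  have h3 : |Real.pi * (t - round t)| ≤ Real.pi / 2 := by
    rw [abs_mul, abs_of_pos hpi]; nlinarith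
  have h4 := Real.mul_abs_le_abs_sin h3
  rw [abs_mul, abs_of_pos hpi, ← mul_assoc, div_mul_cancel₀ _ hpi.ne'] at h4
  have h5 : Real.pi * (t - round t) = Real.pi * t - round t * Real.pi := by ring
  rw [h5, Real.sin_sub_int_mul_pi, abs_mul, abs_neg_one_zpow, one_mul] at h4
  linarith

/-- There are cutoffs `R j → ∞` staying uniformly away from all multiples of `1 / (2 L)`. -/
lemma exists_good_sequence (Ls : List ℝ) (hLs : ∀ L ∈ Ls, 0 < L) :
    ∃ δ : ℝ, 0 < δ ∧ ∃ R : ℕ → ℝ, Tendsto R atTop atTop ∧ (∀ j, 0 < R j) ∧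
      ∀ j, ∀ L ∈ Ls, δ ≤ |Real.sin (2 * Real.pi * R j * L)| := by
  obtain ⟨δ, hδ, h⟩ := exists_forall_le_abs_sub_int Ls hLs 1 one_pos
  choose R hR hR' using fun j : ℕ => h (j + 1)
  refine ⟨2 * δ, by positivity, R, ?_, fun j => ?_, fun j L hL => ?_⟩
  · exact tendsto_atTop_mono (fun j => (by linarith [(hR j).1] : (j : ℝ) ≤ R j))
      tendsto_natCast_atTop_atTop
  · linarith [(hR j).1, (Nat.cast_nonneg j : (0 : ℝ) ≤ j)]
  · have := le_abs_sin_pi_mul (hR' j L hL)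
    convert this using 3
    ring

/-! ### Bounds for the product of geometric series -/

open Complex

/-- The product of the geometric series `1 / (1 - exp (-s L))`. -/
noncomputable def geomProd {ι : Type*} [Fintype ι] (L : ι → ℝ) (s : ℂ) : ℂ :=
  ∏ u, (1 - Complex.exp (-(s * L u)))⁻¹

lemma im_one_sub_exp (s : ℂ) (L : ℝ) :
    (1 - Complex.exp (-(s * L))).im = Real.exp (-(s.re * L)) * Real.sin (s.im * L) := by
  simp [Complex.exp_im]

/-- The modulus is bounded below by the imaginary part alone. For this reason the cutoffs avoid the
multiples of 1/(2L), not just those of 1/L where the poles lie. -/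
lemma mul_exp_le_norm_one_sub_exp {s : ℂ} {L δ : ℝ} (h : δ ≤ |Real.sin (s.im * L)|) :
    δ * Real.exp (-(s.re * L)) ≤ ‖1 - Complex.exp (-(s * L))‖ := by
  refine le_trans ?_ (Complex.abs_im_le_norm _)
  rw [im_one_sub_exp, abs_mul, Real.abs_exp, mul_comm]
  gcongr

/-- 1 - exp(-sL) = -exp(-sL)(1 - exp(sL)), and the previous bound at -s cancels the exponential. The
result is uniform in the real part. -/
lemma le_norm_one_sub_exp {s : ℂ} {L δ : ℝ} (h : δ ≤ |Real.sin (s.im * L)|) :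
    δ ≤ ‖1 - Complex.exp (-(s * L))‖ := by
  have e : 1 - Complex.exp (-(s * L)) =
      -(Complex.exp (-(s * L)) * (1 - Complex.exp (-((-s) * L)))) := by
    rw [mul_sub, ← Complex.exp_add]
    simp
  have h' : δ ≤ |Real.sin ((-s).im * L)| := by simpa using h
  have := mul_exp_le_norm_one_sub_exp h'
  rw [e, norm_neg, norm_mul, Complex.norm_exp]
  calc δ = Real.exp (-(s.re * L)) * (δ * Real.exp (-((-s).re * L))) := by
        rw [mul_left_comm, ← Real.exp_add]; simp
    _ ≤ _ := by
        have e2 : (-(s * L)).re = -(s.re * L) := by simp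
        rw [e2]
        exact mul_le_mul_of_nonneg_left this (Real.exp_pos _).le

/-- One factor supplies the decay exp(L u · Re s) that makes the horizontal edges integrable towards
-∞; the others are bounded by δ⁻¹. -/
lemma norm_geomProd_le {ι : Type*} [Fintype ι] {L : ι → ℝ} {s : ℂ} {δ : ℝ} (hδ : 0 < δ)
    (h : ∀ u, δ ≤ |Real.sin (s.im * L u)|) (u : ι) :
    ‖geomProd L s‖ ≤ δ⁻¹ ^ Fintype.card ι * Real.exp (L u * s.re) := by
  classical
  rw [geomProd, norm_prod, ← Finset.mul_prod_erase _ _ (Finset.mem_univ u)]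
  have h1 : ‖(1 - Complex.exp (-(s * L u)))⁻¹‖ ≤ δ⁻¹ * Real.exp (L u * s.re) := by
    rw [norm_inv]
    have := mul_exp_le_norm_one_sub_exp (h u)
    refine (inv_anti₀ (by positivity) this).trans_eq ?_
    rw [mul_inv, ← Real.exp_neg, neg_neg, mul_comm (L u)]
  have h2 : ∏ v ∈ Finset.univ.erase u, ‖(1 - Complex.exp (-(s * L v)))⁻¹‖ ≤
      δ⁻¹ ^ (Fintype.card ι - 1) := by
    rw [← Finset.card_univ, ← Finset.card_erase_of_mem (Finset.mem_univ u)]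
    rw [← Finset.prod_const]
    refine Finset.prod_le_prod (fun _ _ => norm_nonneg _) fun v _ => ?_
    rw [norm_inv]
    exact inv_anti₀ hδ (le_norm_one_sub_exp (h v))
  calc _ ≤ (δ⁻¹ * Real.exp (L u * s.re)) * δ⁻¹ ^ (Fintype.card ι - 1) :=
        mul_le_mul h1 h2 (Finset.prod_nonneg fun _ _ => norm_nonneg _) (by positivity)
    _ = _ := by
        have : Fintype.card ι = (Fintype.card ι - 1) + 1 :=
          (Nat.sub_add_cancel (Fintype.card_pos_iff.2 ⟨u⟩)).symm
        rw [this, pow_succ, Nat.add_sub_cancel]; ring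

/-- Far to the left |exp(-s L u)| ≥ 2, so each denominator has modulus at least 1. -/
lemma norm_geomProd_le_one {ι : Type*} [Fintype ι] {L : ι → ℝ} {s : ℂ}
    (h : ∀ u, 1 ≤ -(s.re * L u)) : ‖geomProd L s‖ ≤ 1 := by
  rw [geomProd, norm_prod]
  refine Finset.prod_le_one (fun _ _ => norm_nonneg _) fun u _ => ?_
  rw [norm_inv]
  refine inv_le_one_of_one_le₀ ?_
  have h1 := norm_sub_norm_le (Complex.exp (-(s * L u))) 1
  rw [norm_sub_rev, Complex.norm_exp, norm_one] at h1
  have h2 : (-(s * L u)).re = -(s.re * L u) := by simp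
  have h3 := Real.add_one_le_exp (-(s.re * L u))
  rw [h2] at h1
  linarith [h u]

section Rect

variable {x₀ x₁ y₀ y₁ : ℝ}

lemma continuousOn_eval_div_pow (h0 : 0 ∈ openRect x₀ x₁ y₀ y₁) (p : Polynomial ℂ) (n : ℕ) :
    ContinuousOn (fun s => p.eval s / s ^ n) (rectBdry x₀ x₁ y₀ y₁) := by
  refine ContinuousOn.div p.continuous.continuousOn (by fun_prop) fun s hs => ?_
  have := sub_ne_zero_of_mem_rectBdry h0 hs
  exact pow_ne_zero _ (by simpa using this)

/-- By linearity it suffices to treat powers of s. Only s⁻¹ contributes, since the other negative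
powers have primitives on the boundary and the nonnegative ones are entire. -/
lemma rectInt_eval_div_pow (h0 : 0 ∈ openRect x₀ x₁ y₀ y₁) (p : Polynomial ℂ) (n : ℕ) :
    rectInt (fun s => p.eval s / s ^ (n + 1)) x₀ x₁ y₀ y₁ = 2 * Real.pi * I * p.coeff n := by
  obtain ⟨h1, h2, h3, h4⟩ := id h0
  have hx : x₀ ≤ x₁ := (h1.trans h2).le
  have hy : y₀ ≤ y₁ := (h3.trans h4).le
  have hne : ∀ s ∈ rectBdry x₀ x₁ y₀ y₁, s ≠ 0 := fun s hs => by
    simpa using sub_ne_zero_of_mem_rectBdry h0 hs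
  induction p using Polynomial.induction_on' with
  | add p q hp hq =>
    simp only [Polynomial.eval_add, add_div, Polynomial.coeff_add, mul_add]
    rw [rectInt_add hx hy (continuousOn_eval_div_pow h0 _ _) (continuousOn_eval_div_pow h0 _ _),
      hp, hq]
  | monomial i c =>
    simp only [Polynomial.eval_monomial, Polynomial.coeff_monomial, mul_div_assoc]
    rw [rectInt_const_mul]
    rcases lt_trichotomy i n with h | rfl | h
    · obtain ⟨m, rfl⟩ := Nat.exists_eq_add_of_lt h
      rw [rectInt_congr hx hy (g := fun s => ((s - 0) ^ (m + 2))⁻¹), rectInt_inv_sub_pow h0]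
      · simp [h.ne]
      · intro s hs
        have := hne s hs
        simp only [sub_zero]
        field_simp
        ring
    · rw [rectInt_congr hx hy (g := fun s => (s - 0)⁻¹), rectInt_inv_sub h0]
      · simp; ring
      · intro s hs
        have := hne s hs
        simp only [sub_zero]
        field_simp
        ring
    · obtain ⟨m, rfl⟩ := Nat.exists_eq_add_of_lt h
      rw [rectInt_congr hx hy (g := fun s => s ^ m), rectInt_eq_zero hx hy]
      · simp [h.ne']
      · intro s _; fun_prop
      · intro s hs
        have := hne s hs
        simp only
        field_simp
        ring

end Rect

lemma sum_Icc_neg_erase_zero (g : ℤ → ℂ) (K : ℕ) :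
    ∑ k ∈ (Finset.Icc (-(K : ℤ)) K).erase 0, g k = ∑ k ∈ Finset.Icc 1 K, (g k + g (-k)) := by
  induction K with
  | zero => simp
  | succ K ih =>
    rw [Finset.sum_Icc_succ_top (by omega), ← ih]
    have : (Finset.Icc (-((K + 1 : ℕ) : ℤ)) (K + 1 : ℕ)).erase 0 =
        insert ((K + 1 : ℕ) : ℤ) (insert (-((K + 1 : ℕ) : ℤ))
          ((Finset.Icc (-(K : ℤ)) K).erase 0)) := by
      ext k; simp; omega
    rw [this, Finset.sum_insert (by simp; omega), Finset.sum_insert (by simp)]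
    ring

/-! ### Poles and residues of the integrand -/

section Pole

variable {ι : Type*}

/-- The poles of `geomProd L` on the imaginary axis. -/
noncomputable def pole (L : ι → ℝ) (u : ι) (k : ℤ) : ℂ := 2 * Real.pi * k * I / L u

lemma pole_neg (L : ι → ℝ) (u : ι) (k : ℤ) :
    pole L u (-k) = (starRingEnd ℂ) (pole L u k) := by
  simp [pole, Complex.conj_ofNat]

lemma pole_re (L : ι → ℝ) (u : ι) (k : ℤ) : (pole L u k).re = 0 := by
  simp [pole, Complex.div_ofReal_re]

lemma pole_im (L : ι → ℝ) (u : ι) (k : ℤ) : (pole L u k).im = 2 * Real.pi * k / L u := by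
  simp [pole, Complex.div_ofReal_im]

lemma exp_neg_pole_mul_self {L : ι → ℝ} {u : ι} (hL : 0 < L u) (k : ℤ) :
    Complex.exp (-(pole L u k * L u)) = 1 := by
  rw [Complex.exp_eq_one_iff]
  refine ⟨-k, ?_⟩
  have : (L u : ℂ) ≠ 0 := by exact_mod_cast hL.ne'
  simp only [pole]
  field_simp
  push_cast; ring

lemma eq_pole_of_exp_eq_one {L : ι → ℝ} {u : ι} (hL : 0 < L u) {s : ℂ}
    (h : Complex.exp (-(s * L u)) = 1) : ∃ k, s = pole L u k := by
  obtain ⟨m, hm⟩ := Complex.exp_eq_one_iff.1 h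
  refine ⟨-m, ?_⟩
  have : (L u : ℂ) ≠ 0 := by exact_mod_cast hL.ne'
  simp only [pole]
  field_simp
  push_cast
  linear_combination -hm

/-- No nonzero integer multiple of one of the `L u` is an integer multiple of another one. -/
def Incommensurable (L : ι → ℝ) : Prop :=
  ∀ u v, u ≠ v → ∀ m n : ℤ, (m : ℝ) * L u = n * L v → m = 0

/-- This makes the poles off the origin simple and distinct. The condition k ≠ 0 excludes the
origin, which is a pole of every factor. -/
lemma Incommensurable.eq_of_pole_eq {L : ι → ℝ} (hL : ∀ u, 0 < L u) (h : Incommensurable L)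
    {u v : ι} {k m : ℤ} (hk : k ≠ 0) (e : pole L u k = pole L v m) : u = v ∧ k = m := by
  have e' := congrArg im e
  have h1 := hL u
  have h2 := hL v
  have hpi := Real.pi_pos
  rw [pole_im, pole_im, div_eq_div_iff h1.ne' h2.ne'] at e'
  have e2 : (k : ℝ) * L v = m * L u :=
    mul_left_cancel₀ (by positivity : (2 * Real.pi) ≠ 0) (by linarith)
  have huv : u = v := by
    by_contra huv
    exact hk (h v u (Ne.symm huv) _ _ e2)
  subst huv
  exact ⟨rfl, by exact_mod_cast mul_right_cancel₀ h1.ne' e2⟩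

end Pole

lemma differentiableAt_exp_mul_geomProd_div {ι : Type*} [Fintype ι] {L : ι → ℝ} (X : ℝ) {s : ℂ} (hs : s ≠ 0)
    (h : ∀ u, 1 - Complex.exp (-(s * L u)) ≠ 0) :
    DifferentiableAt ℂ (fun s => Complex.exp (s * X) * geomProd L s / s) s := by
  refine DifferentiableAt.fun_div (DifferentiableAt.fun_mul (by fun_prop) ?_) differentiableAt_id hs
  unfold geomProd
  refine DifferentiableAt.fun_finsetProd fun u _ => ?_
  exact DifferentiableAt.fun_inv (by fun_prop) (h u)

section Residue

variable {ι : Type*} [Fintype ι] [DecidableEq ι]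

/-- The residue of `exp (s X) * geomProd L s / s` at `pole L u k`. -/
noncomputable def poleResidue (L : ι → ℝ) (X : ℝ) (u : ι) (k : ℤ) : ℂ :=
  Complex.exp (pole L u k * X) / (pole L u k * L u) *
    ∏ v ∈ Finset.univ.erase u, (1 - Complex.exp (-(pole L u k * L v)))⁻¹

/-- Conjugate poles have conjugate residues, so the poles k and -k together contribute twice a real
part. -/
lemma poleResidue_neg (L : ι → ℝ) (X : ℝ) (u : ι) (k : ℤ) :
    poleResidue L X u (-k) = (starRingEnd ℂ) (poleResidue L X u k) := by
  simp only [poleResidue, pole_neg, map_mul, map_div₀, map_prod, map_inv₀, map_sub, map_one,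
    ← Complex.exp_conj, map_neg, Complex.conj_ofReal]

/-- Only the denominator of index u vanishes at this pole, with derivative L u; incommensurability
keeps the other factors regular there. -/
lemma tendsto_sub_pole_mul {L : ι → ℝ} (hL : ∀ u, 0 < L u) (h : Incommensurable L) (X : ℝ)
    (u : ι) {k : ℤ} (hk : k ≠ 0) :
    Tendsto (fun s => (s - pole L u k) * (Complex.exp (s * X) * geomProd L s / s))
      (𝓝[≠] pole L u k) (𝓝 (poleResidue L X u k)) := by
  set ρ := pole L u k with hρ
  have hLu : (L u : ℂ) ≠ 0 := by exact_mod_cast (hL u).ne'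
  have hρ0 : ρ ≠ 0 := fun h0 => by
    have := congrArg im h0
    rw [hρ, pole_im] at this
    have h1 := (hL u).ne'
    have hpi := Real.pi_pos.ne'
    have hk' : (k : ℝ) ≠ 0 := by exact_mod_cast hk
    simp at this
    tauto
  have hslope : Tendsto (fun s => (s - ρ) * (1 - Complex.exp (-(s * L u)))⁻¹) (𝓝[≠] ρ)
      (𝓝 (L u : ℂ)⁻¹) := by
    have hd : HasDerivAt (fun s => 1 - Complex.exp (-(s * L u))) (L u : ℂ) ρ := by
      have := (((hasDerivAt_id ρ).mul_const (L u : ℂ)).neg.cexp).const_sub 1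
      refine this.congr_deriv ?_
      have e : (-fun y => id y * (L u : ℂ)) ρ = -(ρ * L u) := rfl
      rw [e, exp_neg_pole_mul_self (hL u)]
      ring
    have := (hasDerivAt_iff_tendsto_slope.1 hd).inv₀ hLu
    refine this.congr fun s => ?_
    rw [slope_def_field, exp_neg_pole_mul_self (hL u), sub_self, sub_zero, inv_div,
      div_eq_mul_inv]
  have hrest : ContinuousAt (fun s => Complex.exp (s * X) / s *
      ∏ v ∈ Finset.univ.erase u, (1 - Complex.exp (-(s * L v)))⁻¹) ρ := by
    refine ContinuousAt.mul (by fun_prop (disch := assumption)) ?_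
    refine tendsto_finsetProd _ fun v hv => ?_
    refine ContinuousAt.inv₀ (by fun_prop) fun h0 => ?_
    obtain ⟨m, hm⟩ := eq_pole_of_exp_eq_one (hL v) (sub_eq_zero.1 h0).symm
    exact (Finset.mem_erase.1 hv).1 (h.eq_of_pole_eq hL hk hm).1.symm
  have := hslope.mul (hrest.tendsto.mono_left nhdsWithin_le_nhds)
  have e : (L u : ℂ)⁻¹ * (Complex.exp (ρ * X) / ρ *
      ∏ v ∈ Finset.univ.erase u, (1 - Complex.exp (-(ρ * L v)))⁻¹) = poleResidue L X u k := by
    rw [poleResidue, ← hρ]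
    field_simp
  rw [e] at this
  refine this.congr fun s => ?_
  rw [geomProd, ← Finset.mul_prod_erase _ _ (Finset.mem_univ u)]
  ring

/-- The residue theorem above allows only simple poles, while the origin has higher order.
Subtracting p(s) / s ^ (n + 1) leaves residue 0 there by `hp`, and the subtracted term integrates to
the coefficient of s ^ n. -/
lemma rectInt_geomProd {L : ι → ℝ} (hL : ∀ u, 0 < L u) (h : Incommensurable L) {X R K : ℝ}
    (hK : 0 < K) (hR : 0 < R) (hsin : ∀ u, Real.sin (2 * Real.pi * R * L u) ≠ 0)
    {p : Polynomial ℂ} {n : ℕ}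
    (hp : Tendsto (fun s : ℂ => s * (Complex.exp (s * X) * geomProd L s / s -
      p.eval s / s ^ (n + 1))) (𝓝[≠] 0) (𝓝 0)) :
    rectInt (fun s => Complex.exp (s * X) * geomProd L s / s) (-K) 1 (-(2 * Real.pi * R))
      (2 * Real.pi * R) = 2 * Real.pi * I *
        (p.coeff n + ∑ u, ∑ k ∈ Finset.Icc 1 ⌊R * L u⌋₊,
          (poleResidue L X u k + poleResidue L X u (-k))) := by
  have hpi := Real.pi_pos
  set T := 2 * Real.pi * R with hTdef
  have hT : 0 < T := by positivity
  set f : ℂ → ℂ := fun s => Complex.exp (s * X) * geomProd L s / s with hf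
  have h0 : (0 : ℂ) ∈ openRect (-K) 1 (-T) T := by simp [openRect, hK, hT]
  -- `none` indexes the origin, where the corrected integrand has residue 0; `some ⟨u, k⟩` indexes
  -- the nonzero poles up to the height 2πR.
  set J : Finset (Option (Σ _ : ι, ℤ)) := Finset.insertNone
    (Finset.univ.sigma fun u => (Finset.Icc (-(⌊R * L u⌋₊ : ℤ)) ⌊R * L u⌋₊).erase 0) with hJ
  set ρ : Option (Σ _ : ι, ℤ) → ℂ := fun i => i.elim 0 fun i => pole L i.1 i.2 with hρ
  have hmem : ∀ (u : ι) (k : ℤ), some ⟨u, k⟩ ∈ J ↔ k ≠ 0 ∧ |(k : ℝ)| ≤ R * L u := fun u k => by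
    have : |(k : ℝ)| ≤ R * L u ↔ -(⌊R * L u⌋₊ : ℤ) ≤ k ∧ k ≤ ⌊R * L u⌋₊ := by
      rw [← Int.cast_abs, Int.natCast_floor_eq_floor (mul_nonneg hR.le (hL u).le), ← abs_le,
        Int.le_floor]
    rw [this]
    simp [hJ]
  have hpole_ne : ∀ u k, k ≠ 0 → pole L u k ≠ 0 := fun u k hk hz => by
    have := congrArg im hz
    rw [pole_im] at this
    have h1 := (hL u).ne'
    have hk' : (k : ℝ) ≠ 0 := by exact_mod_cast hk
    simp [hpi.ne'] at this
    tauto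
  have hopen : ∀ u (k : ℤ), |(k : ℝ)| ≤ R * L u → pole L u k ∈ openRect (-K) 1 (-T) T :=
    fun u k hk => by
      have hLu := hL u
      -- Equality would put the pole on a horizontal edge, where 2πR L u = 2|k|π and the sine
      -- vanishes.
      have hlt : |(k : ℝ)| < R * L u := lt_of_le_of_ne hk fun e => hsin u (by
        have e1 : T * L u = (2 * |k| : ℤ) * Real.pi := by
          push_cast; rw [e, hTdef]; ring
        rw [e1, Real.sin_int_mul_pi])
      rw [abs_lt] at hlt
      simp only [openRect, Set.mem_ofPred_eq, pole_re, pole_im]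
      refine ⟨by linarith, one_pos, ?_, ?_⟩
      · rw [lt_div_iff₀ hLu, hTdef]; nlinarith
      · rw [div_lt_iff₀ hLu, hTdef]; nlinarith
  have hclosed : ∀ u (k : ℤ), pole L u k ∈ closedRect (-K) 1 (-T) T → |(k : ℝ)| ≤ R * L u :=
    fun u k hk => by
      have hLu := hL u
      have h1 := hk.2.2.1
      have h2 := hk.2.2.2
      rw [pole_im, le_div_iff₀ hLu, hTdef] at h1
      rw [pole_im, div_le_iff₀ hLu, hTdef] at h2
      rw [abs_le]
      constructor <;> refine le_of_mul_le_mul_left ?_ (by positivity : 0 < 2 * Real.pi) <;>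
        linarith
  have hres := rectInt_eq_sum_residues (x₀ := -K) (x₁ := 1) (y₀ := -T) (y₁ := T) (by linarith)
    (by linarith) J ρ (fun i => i.elim 0 fun i => poleResidue L X i.1 i.2)
    (fun s => f s - p.eval s / s ^ (n + 1)) ?_ ?_ ?_ ?_
  · have hdiff : ContinuousOn f (rectBdry (-K) 1 (-T) T) := by
      intro s hs
      refine (differentiableAt_exp_mul_geomProd_div X
        (by simpa using sub_ne_zero_of_mem_rectBdry h0 hs)
        fun u hu => ?_).continuousAt.continuousWithinAt
      obtain ⟨k, rfl⟩ := eq_pole_of_exp_eq_one (hL u) (sub_eq_zero.1 hu).symm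
      exact hs.2 (hopen u k (hclosed u k hs.1))
    have e := rectInt_add (by linarith) (by linarith)
      (hdiff.sub (continuousOn_eval_div_pow h0 p (n + 1))) (continuousOn_eval_div_pow h0 p (n + 1))
    have e' : rectInt f (-K) 1 (-T) T = rectInt (fun s => (f s - p.eval s / s ^ (n + 1)) +
      p.eval s / s ^ (n + 1)) (-K) 1 (-T) T := by simp only [sub_add_cancel]
    rw [e']
    refine e.trans ?_
    refine (congrArg₂ (· + ·) hres (rectInt_eval_div_pow h0 p n)).trans ?_
    rw [hJ, Finset.sum_insertNone, Finset.sum_sigma]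
    simp only [Option.elim, sum_Icc_neg_erase_zero]
    ring
  · rintro (_ | ⟨u, k⟩) hi (_ | ⟨v, m⟩) hj e
    · rfl
    · exact absurd e.symm (hpole_ne v m ((hmem v m).1 hj).1)
    · exact absurd e (hpole_ne u k ((hmem u k).1 hi).1)
    · obtain ⟨rfl, rfl⟩ := h.eq_of_pole_eq hL ((hmem u k).1 hi).1 e
      rfl
  · rintro (_ | ⟨u, k⟩) hi
    · exact h0
    · exact hopen u k ((hmem u k).1 hi).2
  · intro s hs hs'
    have hs0 : s ≠ 0 := fun e => hs' ⟨none, by simp [hJ], e.symm⟩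
    refine (differentiableAt_exp_mul_geomProd_div X hs0 fun u hu => ?_).sub
      (p.differentiable.differentiableAt.fun_div (by fun_prop) (pow_ne_zero _ hs0))
    obtain ⟨k, rfl⟩ := eq_pole_of_exp_eq_one (hL u) (sub_eq_zero.1 hu).symm
    refine hs' ⟨some ⟨u, k⟩, (hmem u k).2 ⟨?_, hclosed u k hs⟩, rfl⟩
    rintro rfl
    exact hs0 (by simp [pole])
  · rintro (_ | ⟨u, k⟩) hi
    · simpa [hρ, hf] using hp
    · have hk := ((hmem u k).1 hi).1
      have hc : ContinuousAt (fun s => (s - pole L u k) * (p.eval s / s ^ (n + 1)))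
          (pole L u k) := by
        have h1 := pow_ne_zero (n + 1) (hpole_ne u k hk)
        have h2 := p.continuous.continuousAt (x := pole L u k)
        fun_prop (disch := assumption)
      have h1 := hc.tendsto.mono_left (nhdsWithin_le_nhds (s := {pole L u k}ᶜ))
      rw [sub_self, zero_mul] at h1
      have h2 := (tendsto_sub_pole_mul hL h X u hk).sub h1
      rw [sub_zero] at h2
      exact h2.congr fun s => by simp only [hf, hρ, Option.elim]; ring

/-- The residue formula, summed over the poles up to a good sequence of heights. -/
theorem tendsto_sum_poleResidue [Nonempty ι] {L : ι → ℝ} (hL : ∀ u, 0 < L u)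
    (h : Incommensurable L) {R : ℕ → ℝ} {δ : ℝ} (hδ : 0 < δ) (hR : Tendsto R atTop atTop)
    (hR0 : ∀ j, 0 < R j) (hsin : ∀ j u, δ ≤ |Real.sin (2 * Real.pi * R j * L u)|)
    {X : ℝ} (hX : 0 ≤ X) {κ : Type*} [Countable κ] {lam : κ → ℝ}
    (hs : Summable fun i => Real.exp (-lam i))
    (hF : ∀ y : ℝ, HasSum (fun i => Complex.exp (-(((1 : ℝ) + y * I) * lam i)))
      (geomProd L ((1 : ℝ) + y * I)))
    {p : Polynomial ℂ} {n : ℕ}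
    (hp : Tendsto (fun s : ℂ => s * (Complex.exp (s * X) * geomProd L s / s -
      p.eval s / s ^ (n + 1))) (𝓝[≠] 0) (𝓝 0)) :
    Tendsto (fun j => ∑ u, ∑ k ∈ Finset.Icc 1 ⌊R j * L u⌋₊, 2 * (poleResidue L X u k).re) atTop
      (𝓝 ((∑' i, perronStep (X - lam i)) - (p.coeff n).re)) := by
  have hpi := Real.pi_pos
  obtain ⟨u₀⟩ := ‹Nonempty ι›
  set T : ℕ → ℝ := fun j => 2 * Real.pi * R j with hTdef
  have hT : ∀ j, 0 < T j := fun j => mul_pos (by positivity) (hR0 j)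
  have hTt : Tendsto T atTop atTop := hR.const_mul_atTop (by positivity)
  set f : ℂ → ℂ := fun s => Complex.exp (s * X) * geomProd L s / s with hf
  set D : ℝ := Real.exp X * δ⁻¹ ^ Fintype.card ι with hD
  set S : ℕ → ℂ := fun j => p.coeff n + ∑ u, ∑ k ∈ Finset.Icc 1 ⌊R j * L u⌋₊,
          (poleResidue L X u k + poleResidue L X u (-k)) with hS
  -- On the horizontal edges 1/|s| gives 1/T, and exp(σX) ≤ exp X because σ ≤ 1 and X ≥ 0. The
  -- constant D does not depend on j.
  have hb : ∀ (j : ℕ) (σ t : ℝ), |t| = T j → σ ≤ 1 →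
      ‖f (σ + t * I)‖ ≤ D / T j * Real.exp (L u₀ * σ) := fun j σ t ht hσ => by
    have h1 := abs_le_norm_add_mul_I σ t
    have h2 : ‖geomProd L (σ + t * I)‖ ≤ _ := norm_geomProd_le hδ (fun u => by
      have := hsin j u
      have e : ((σ + t * I : ℂ)).im = t := by simp
      rw [e]
      rcases abs_eq (hT j).le |>.1 ht with rfl | rfl
      · exact this
      · rwa [neg_mul, Real.sin_neg, abs_neg]) u₀
    have e : ((σ + t * I : ℂ)).re = σ := by simp
    rw [e] at h2
    rw [hf, norm_div, norm_mul, norm_exp_mul_ofReal, e]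
    have h3 : Real.exp (σ * X) ≤ Real.exp X := Real.exp_le_exp.2 (by nlinarith)
    rw [ht] at h1
    have hTj := hT j
    calc _ ≤ Real.exp X * (δ⁻¹ ^ Fintype.card ι * Real.exp (L u₀ * σ)) / T j := by gcongr
      _ = _ := by rw [hD]; ring
  have key : ∀ j, ‖(∫ y : ℝ in (-T j)..T j, f ((1 : ℝ) + y * I)) - 2 * Real.pi * S j‖ ≤
      2 * (D / T j * Real.exp (L u₀) / L u₀) := fun j => by
    refine norm_integral_vertical_sub_le (ε := fun K => 1 * Real.exp (-K * X) / K) (hT j) (hL u₀)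
      (fun σ hσ => hb j σ _ (abs_of_pos (hT j)) hσ)
      (fun σ hσ => hb j σ _ (by rw [abs_neg, abs_of_pos (hT j)]) hσ) ?_
      (tendsto_inv_mul_exp_neg hX 1) ?_
    · have hlarge : ∀ᶠ K : ℝ in atTop, ∀ u, 1 ≤ K * L u :=
        eventually_all.2 fun u => (tendsto_id.atTop_mul_const (hL u)).eventually_ge_atTop 1
      filter_upwards [hlarge, eventually_gt_atTop 0] with K hK hK0 y _
      have h1 := abs_le_norm_add_mul_I' (-K) y
      rw [abs_neg, abs_of_pos hK0] at h1
      have e : (((-K : ℝ) + y * I : ℂ)).re = -K := by simp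
      have h2 : ‖geomProd L ((-K : ℝ) + y * I)‖ ≤ 1 := norm_geomProd_le_one fun u => by
        rw [e]; linarith [hK u]
      rw [hf, norm_div, norm_mul, norm_exp_mul_ofReal, e, mul_comm]
      gcongr
    · filter_upwards [eventually_gt_atTop 0] with K hK
      exact rectInt_geomProd hL h hK (hR0 j)
        (fun u e => by have := hsin j u; rw [e, abs_zero] at this; linarith) hp
  have hlim0 : Tendsto (fun j => (∫ y : ℝ in (-T j)..T j, f ((1 : ℝ) + y * I)) -
      2 * Real.pi * S j) atTop (𝓝 0) := by
    refine squeeze_zero_norm key ?_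
    have := (((tendsto_inv_atTop_zero.comp hTt).const_mul D).mul_const
      (Real.exp (L u₀))).div_const (L u₀) |>.const_mul 2
    simpa [div_eq_mul_inv] using this
  have hperron := (tendsto_perron hs hF X).comp hTt
  have hSlim : Tendsto S atTop (𝓝 (((∑' i, perronStep (X - lam i) : ℝ) : ℂ))) := by
    have h1 := (hperron.sub hlim0).const_mul ((2 * Real.pi : ℂ)⁻¹)
    have hpi' : (2 * Real.pi : ℂ) ≠ 0 := by
      simp
    rw [sub_zero, inv_mul_cancel_left₀ hpi'] at h1
    refine h1.congr fun j => ?_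
    simp only [Function.comp, hf, sub_sub_cancel]
    rw [inv_mul_cancel_left₀ hpi']
  have hre := ((Complex.continuous_re.tendsto _).comp hSlim).sub_const (p.coeff n).re
  rw [ofReal_re] at hre
  refine hre.congr fun j => ?_
  simp only [Function.comp, hS, add_re, re_sum, poleResidue_neg, conj_re]
  rw [add_sub_cancel_left]
  refine Finset.sum_congr rfl fun u _ => Finset.sum_congr rfl fun k _ => ?_
  ring

end Residue

/-! ### Taylor expansion and the residue at the origin -/

section Expansion

open Asymptotics

/-- `h` agrees with the polynomial `p` near `0` up to an error `O(s ^ 5)`. -/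
def HasExpansion (h : ℂ → ℂ) (p : Polynomial ℝ) : Prop :=
  (fun s : ℂ => h s - (p.map Complex.ofRealHom).eval s) =O[𝓝[≠] 0] fun s : ℂ => s ^ 5

lemma HasExpansion.mul {h₁ h₂ : ℂ → ℂ} {p₁ p₂ : Polynomial ℝ} (e₁ : HasExpansion h₁ p₁)
    (e₂ : HasExpansion h₂ p₂) : HasExpansion (fun s => h₁ s * h₂ s) (p₁ * p₂) := by
  have hb : ∀ p : Polynomial ℝ,
      (fun s : ℂ => (p.map Complex.ofRealHom).eval s) =O[𝓝[≠] 0] fun _ => (1 : ℂ) := fun p =>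
    (((p.map Complex.ofRealHom).continuous.tendsto 0).mono_left nhdsWithin_le_nhds).isBigO_one ℂ
  have h5 : (fun s : ℂ => s ^ 5) =O[𝓝[≠] 0] fun _ => (1 : ℂ) :=
    (((continuous_pow 5).tendsto (0 : ℂ)).mono_left nhdsWithin_le_nhds).isBigO_one ℂ
  have h1 : h₁ =O[𝓝[≠] 0] fun _ => (1 : ℂ) := by
    simpa using (e₁.trans h5).add (hb p₁)
  have t1 := h1.mul e₂
  have t2 := IsBigO.mul e₁ (hb p₂)
  simp only [one_mul, mul_one] at t1 t2
  refine (t1.add t2).congr_left fun s => ?_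
  rw [Polynomial.map_mul, Polynomial.eval_mul]
  ring

/-- The Taylor polynomial of degree `4` of `exp (s X)`. -/
noncomputable def expPoly (X : ℝ) : Polynomial ℝ :=
  ∑ i ∈ Finset.range 5, Polynomial.monomial i (X ^ i / i.factorial)

/-- The Taylor polynomial of degree `4` of `s / (1 - exp (-s L))`. -/
noncomputable def bernoulliPoly (L : ℝ) : Polynomial ℝ :=
  Polynomial.monomial 0 (1 / L) + Polynomial.monomial 1 (1 / 2) + Polynomial.monomial 2 (L / 12)
    - Polynomial.monomial 4 (L ^ 3 / 720)

lemma isBigO_exp_sub_sum (c : ℂ) (n : ℕ) :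
    (fun s : ℂ => Complex.exp (s * c) - ∑ i ∈ Finset.range n, (s * c) ^ i / i.factorial)
      =O[𝓝[≠] 0] fun s : ℂ => s ^ n := by
  have ht : Tendsto (fun s : ℂ => s * c) (𝓝[≠] 0) (𝓝 0) := by
    have : Tendsto (fun s : ℂ => s * c) (𝓝 0) (𝓝 (0 * c)) :=
      Continuous.tendsto (by fun_prop) 0
    rw [zero_mul] at this
    exact this.mono_left nhdsWithin_le_nhds
  refine ((Complex.exp_sub_sum_range_isBigO_pow n).comp_tendsto ht).trans ?_
  refine (isBigO_const_mul_self (c ^ n) (fun s : ℂ => s ^ n) _).congr_left fun s => ?_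
  simp only [Function.comp]; ring

lemma hasExpansion_exp (X : ℝ) : HasExpansion (fun s => Complex.exp (s * X)) (expPoly X) := by
  refine (isBigO_exp_sub_sum X 5).congr_left fun s => ?_
  simp only [expPoly, Polynomial.map_sum, Polynomial.map_monomial, Polynomial.eval_finsetSum,
    Polynomial.eval_monomial]
  congr 1
  refine Finset.sum_congr rfl fun i _ => ?_
  simp
  ring

/-- With E = 1 - exp(-sL) and q the polynomial, s - qE is O(s⁶) by direct multiplication, and s/E is
bounded. Hence s/E - q = (s - qE)(s/E)s⁻¹ is O(s⁵). -/
lemma hasExpansion_bernoulli {L : ℝ} (hL : 0 < L) :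
    HasExpansion (fun s => s * (1 - Complex.exp (-(s * L)))⁻¹) (bernoulliPoly L) := by
  have hL0 : (L : ℂ) ≠ 0 := by exact_mod_cast hL.ne'
  have hd : HasDerivAt (fun s : ℂ => 1 - Complex.exp (-(s * L))) (L : ℂ) 0 := by
    have := (((hasDerivAt_id (0 : ℂ)).mul_const (L : ℂ)).neg.cexp).const_sub 1
    refine this.congr_deriv ?_
    simp
  have hphi : (fun s : ℂ => s * (1 - Complex.exp (-(s * L)))⁻¹) =O[𝓝[≠] 0] fun _ => (1 : ℂ) := by
    have := (hasDerivAt_iff_tendsto_slope.1 hd).inv₀ hL0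
    refine (this.isBigO_one ℂ).congr_left fun s => ?_
    rw [slope_def_field]
    simp [div_eq_mul_inv]
  have hne : ∀ᶠ s : ℂ in 𝓝[≠] 0, 1 - Complex.exp (-(s * L)) ≠ 0 := by
    have := hd.eventually_ne (c := 0) hL0
    simpa using this
  set q : ℂ → ℂ := fun s => ((bernoulliPoly L).map Complex.ofRealHom).eval s with hq
  have hqe : ∀ s, q s = 1 / L + s / 2 + L * s ^ 2 / 12 - L ^ 3 * s ^ 4 / 720 := fun s => by
    simp [hq, bernoulliPoly]; ring
  have hqb : q =O[𝓝[≠] 0] fun _ => (1 : ℂ) :=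
    ((((bernoulliPoly L).map Complex.ofRealHom).continuous.tendsto 0).mono_left
      nhdsWithin_le_nhds).isBigO_one ℂ
  have hexp := isBigO_exp_sub_sum (-L) 6
  -- This polynomial is exactly s - q(s) times the Taylor polynomial of degree 5 of 1 - exp(-sL):
  -- all its terms below s⁶ cancel.
  have hrem : (fun s : ℂ => s ^ 6 * (-(L ^ 5 / 720 + L ^ 6 * s / 2160 + L ^ 7 * s ^ 2 / 17280
      - L ^ 8 * s ^ 3 / 86400))) =O[𝓝[≠] 0] fun s : ℂ => s ^ 6 := by
    have hc : Continuous fun s : ℂ => (-(L ^ 5 / 720 + L ^ 6 * s / 2160 + L ^ 7 * s ^ 2 / 17280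
      - L ^ 8 * s ^ 3 / 86400) : ℂ) := by fun_prop
    have := (isBigO_refl (fun s : ℂ => s ^ 6) (𝓝[≠] 0)).mul
      (((hc.tendsto 0).mono_left nhdsWithin_le_nhds).isBigO_one ℂ)
    simpa using this
  have hnum : (fun s : ℂ => s - q s * (1 - Complex.exp (-(s * L)))) =O[𝓝[≠] 0]
      fun s : ℂ => s ^ 6 := by
    have := hrem.add (hqb.mul hexp |>.congr_right fun s => one_mul _)
    refine this.congr_left fun s => ?_
    simp only [hqe, Finset.sum_range_succ, Finset.sum_range_zero, mul_neg]
    simp [Nat.factorial]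
    field_simp
    ring
  have h := (hnum.mul hphi).mul (isBigO_refl (fun s : ℂ => s⁻¹) (𝓝[≠] 0))
  refine h.congr' ?_ ?_
  · filter_upwards [hne, self_mem_nhdsWithin] with s h1 h2
    have h2 : s ≠ 0 := h2
    change _ = _ - q s
    field_simp
  · filter_upwards [self_mem_nhdsWithin] with s h2
    have h2 : s ≠ 0 := h2
    field_simp

/-- The expression is the expansion error O(s⁵) divided by sⁿ, so n ≤ 4 is what makes it vanish at
the origin. -/
lemma tendsto_of_hasExpansion {ι : Type*} [Fintype ι] {L : ι → ℝ} {X : ℝ} {n : ℕ} (hn : n ≤ 4)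
    {p : Polynomial ℝ}
    (h : HasExpansion (fun s => Complex.exp (s * X) * (s ^ n * geomProd L s)) p) :
    Tendsto (fun s : ℂ => s * (Complex.exp (s * X) * geomProd L s / s -
      (p.map Complex.ofRealHom).eval s / s ^ (n + 1))) (𝓝[≠] 0) (𝓝 0) := by
  obtain ⟨m, hm⟩ := Nat.exists_eq_add_of_le hn
  have h1 := IsBigO.mul h (isBigO_refl (fun s : ℂ => (s ^ n)⁻¹) (𝓝[≠] 0))
  have h2 : Tendsto (fun s : ℂ => s ^ (m + 1)) (𝓝[≠] 0) (𝓝 0) := by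
    have := ((continuous_pow (m + 1)).tendsto (0 : ℂ)).mono_left (nhdsWithin_le_nhds (s := {0}ᶜ))
    simpa using this
  refine (h1.congr' ?_ ?_).trans_tendsto h2
  · filter_upwards [self_mem_nhdsWithin] with s hs
    have hs : s ≠ 0 := hs
    field_simp
    ring
  · filter_upwards [self_mem_nhdsWithin] with s hs
    have hs : s ≠ 0 := hs
    have e : 5 = n + (m + 1) := by omega
    rw [e, pow_add]
    field_simp

/-- The Taylor polynomial of `exp (s X) * ∏ s / (1 - exp (-s L))`. -/
noncomputable def productPoly {n : ℕ} (L : Fin n → ℝ) (X : ℝ) : Polynomial ℝ :=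
  expPoly X * ∏ u, bernoulliPoly (L u)

lemma hasExpansion_productPoly {n : ℕ} {L : Fin n → ℝ} (hL : ∀ u, 0 < L u) (X : ℝ) :
    HasExpansion (fun s => Complex.exp (s * X) * (s ^ n * geomProd L s)) (productPoly L X) := by
  have key : ∀ S : Finset (Fin n), HasExpansion
      (fun s => Complex.exp (s * X) * ∏ u ∈ S, s * (1 - Complex.exp (-(s * L u)))⁻¹)
      (expPoly X * ∏ u ∈ S, bernoulliPoly (L u)) := fun S => by
    induction S using Finset.induction_on with
    | empty => simpa using hasExpansion_exp X
    | insert u S hu ih =>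
      have := ih.mul (hasExpansion_bernoulli (hL u))
      rw [Finset.prod_insert hu, mul_left_comm, mul_comm (bernoulliPoly _)]
      refine this.congr_left fun s => ?_
      simp only [Finset.prod_insert hu]
      ring
  refine (key Finset.univ).congr_left fun s => ?_
  simp only [Finset.prod_mul_distrib, Finset.prod_const, Finset.card_univ, Fintype.card_fin]
  rfl

section Coefficients

variable (p q : Polynomial ℝ)

lemma coeff_mul_one : (p * q).coeff 1 = p.coeff 0 * q.coeff 1 + p.coeff 1 * q.coeff 0 := by
  simp [Polynomial.coeff_mul, Finset.Nat.antidiagonal_succ]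

lemma coeff_mul_two : (p * q).coeff 2 =
    p.coeff 0 * q.coeff 2 + p.coeff 1 * q.coeff 1 + p.coeff 2 * q.coeff 0 := by
  simp [Polynomial.coeff_mul, Finset.Nat.antidiagonal_succ]; ring

lemma coeff_mul_three : (p * q).coeff 3 = p.coeff 0 * q.coeff 3 + p.coeff 1 * q.coeff 2 +
    p.coeff 2 * q.coeff 1 + p.coeff 3 * q.coeff 0 := by
  simp [Polynomial.coeff_mul, Finset.Nat.antidiagonal_succ]; ring

lemma coeff_mul_four : (p * q).coeff 4 = p.coeff 0 * q.coeff 4 + p.coeff 1 * q.coeff 3 +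
    p.coeff 2 * q.coeff 2 + p.coeff 3 * q.coeff 1 + p.coeff 4 * q.coeff 0 := by
  simp [Polynomial.coeff_mul, Finset.Nat.antidiagonal_succ]; ring

lemma coeff_bernoulliPoly (L : ℝ) : (bernoulliPoly L).coeff 0 = 1 / L ∧
    (bernoulliPoly L).coeff 1 = 1 / 2 ∧ (bernoulliPoly L).coeff 2 = L / 12 ∧
    (bernoulliPoly L).coeff 3 = 0 ∧ (bernoulliPoly L).coeff 4 = -(L ^ 3 / 720) := by
  simp [bernoulliPoly, Polynomial.coeff_monomial]

lemma coeff_expPoly (X : ℝ) : (expPoly X).coeff 0 = 1 ∧ (expPoly X).coeff 1 = X ∧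
    (expPoly X).coeff 2 = X ^ 2 / 2 ∧ (expPoly X).coeff 3 = X ^ 3 / 6 ∧
    (expPoly X).coeff 4 = X ^ 4 / 24 := by
  simp [expPoly, Finset.sum_range_succ, Polynomial.coeff_monomial, Polynomial.coeff_one,
    Nat.factorial]

end Coefficients

lemma coeff_productPoly_one {A : ℝ} (X : ℝ) :
    (productPoly ![A] X).coeff 1 = X / A + 1 / 2 := by
  obtain ⟨a0, a1, a2, a3, a4⟩ := coeff_bernoulliPoly A
  obtain ⟨e0, e1, e2, e3, e4⟩ := coeff_expPoly X
  simp only [productPoly, Fin.prod_univ_one, Matrix.cons_val_zero, coeff_mul_one, a0, a1, e0, e1]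
  ring

lemma coeff_productPoly_four {A B C D : ℝ} (hA : 0 < A) (hB : 0 < B) (hC : 0 < C) (hD : 0 < D)
    (X : ℝ) : (productPoly ![A, B, C, D] X).coeff 4 = mainPoly A B C D X := by
  obtain ⟨a0, a1, a2, a3, a4⟩ := coeff_bernoulliPoly A
  obtain ⟨b0, b1, b2, b3, b4⟩ := coeff_bernoulliPoly B
  obtain ⟨c0, c1, c2, c3, c4⟩ := coeff_bernoulliPoly C
  obtain ⟨d0, d1, d2, d3, d4⟩ := coeff_bernoulliPoly D
  obtain ⟨e0, e1, e2, e3, e4⟩ := coeff_expPoly X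
  have e : productPoly ![A, B, C, D] X = expPoly X * (((bernoulliPoly A * bernoulliPoly B) *
      bernoulliPoly C) * bernoulliPoly D) := by
    rw [productPoly, Fin.prod_univ_four]; rfl
  rw [e, mainPoly]
  simp only [coeff_mul_one, coeff_mul_two, coeff_mul_three, coeff_mul_four, Polynomial.mul_coeff_zero,
    a0, a1, a2, a3, a4, b0, b1, b2, b3, b4, c0, c1, c2, c3, c4, d0, d1, d2, d3, d4, e0, e1, e2,
    e3, e4]
  field_simp
  ring

end Expansion

/-! ### Dirichlet series on the line Re s = 1 -/

section Dirichlet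

open Complex

/-- `F` is given on the line `Re s = 1` by the absolutely convergent series `∑ exp (-s λ)`. -/
def IsDirichletSum {κ : Type*} (lam : κ → ℝ) (F : ℂ → ℂ) : Prop :=
  Summable (fun i => Real.exp (-lam i)) ∧
    ∀ y : ℝ, HasSum (fun i => Complex.exp (-(((1 : ℝ) + y * I) * lam i))) (F ((1 : ℝ) + y * I))

lemma norm_exp_neg_mul (y t : ℝ) : ‖Complex.exp (-(((1 : ℝ) + y * I) * t))‖ = Real.exp (-t) := by
  rw [Complex.norm_exp]; simp

lemma isDirichletSum_geometric {A : ℝ} (hA : 0 < A) :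
    IsDirichletSum (fun p : ℕ => p * A) (fun s => (1 - Complex.exp (-(s * A)))⁻¹) := by
  constructor
  · have := summable_geometric_of_lt_one (Real.exp_pos (-A)).le
      (Real.exp_lt_one_iff.2 (by linarith))
    refine this.congr fun p => ?_
    rw [← Real.exp_nat_mul]; congr 1; ring
  · intro y
    have := hasSum_geometric_of_norm_lt_one
      (ξ := Complex.exp (-(((1 : ℝ) + y * I) * A))) (by
        rw [norm_exp_neg_mul]; exact Real.exp_lt_one_iff.2 (by linarith))
    refine this.congr_fun fun p => ?_
    rw [← Complex.exp_nat_mul]; congr 1; push_cast; ring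

lemma hasSum_mul_of_summable_norm {κ κ' : Type*} {f : κ → ℂ} {g : κ' → ℂ} {a b : ℂ}
    (hf : HasSum f a) (hg : HasSum g b) (hf' : Summable fun i => ‖f i‖)
    (hg' : Summable fun i => ‖g i‖) : HasSum (fun i : κ × κ' => f i.1 * g i.2) (a * b) :=
  hf.mul hg (summable_mul_of_summable_norm hf' hg')

lemma IsDirichletSum.mul {κ κ' : Type*} {lam : κ → ℝ} {mu : κ' → ℝ} {F G : ℂ → ℂ}
    (hF : IsDirichletSum lam F) (hG : IsDirichletSum mu G) :
    IsDirichletSum (fun i : κ × κ' => lam i.1 + mu i.2) (fun s => F s * G s) := by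
  constructor
  · refine (hF.1.mul_of_nonneg hG.1 (fun _ => (Real.exp_pos _).le)
      (fun _ => (Real.exp_pos _).le)).congr fun i => ?_
    rw [← Real.exp_add]; congr 1; ring
  · intro y
    have h1 : Summable fun i => ‖Complex.exp (-(((1 : ℝ) + y * I) * lam i))‖ := by
      simpa only [norm_exp_neg_mul] using hF.1
    have h2 : Summable fun i => ‖Complex.exp (-(((1 : ℝ) + y * I) * mu i))‖ := by
      simpa only [norm_exp_neg_mul] using hG.1
    have h3 := hasSum_mul_of_summable_norm (hF.2 y) (hG.2 y) h1 h2
    refine h3.congr_fun fun i => ?_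
    rw [← Complex.exp_add, ofReal_add, mul_add, neg_add]

end Dirichlet

/-! ### Residues as cotangent terms -/

section Terms

open Complex

variable {ι : Type*} [Fintype ι] [DecidableEq ι]

/-- 1 - exp(-2ia) = 2i sin a · exp(-ia), so the inverse is exp(ia) / (2i sin a). -/
lemma inv_one_sub_exp {a : ℝ} (ha : Real.sin a ≠ 0) :
    (1 - Complex.exp (-(2 * a * I)))⁻¹ = (1 - I * ((Real.cos a / Real.sin a : ℝ) : ℂ)) / 2 := by
  have h1 : (Real.sin a : ℂ) ≠ 0 := by exact_mod_cast ha
  have e : Complex.exp (-(2 * a * I)) = ((Real.cos a : ℂ) - Real.sin a * I) ^ 2 := by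
    have : (-(2 * a * I) : ℂ) = (2 : ℕ) * ((-a : ℝ) * I) := by push_cast; ring
    rw [this, Complex.exp_nat_mul, Complex.exp_mul_I, ← Complex.ofReal_cos, ← Complex.ofReal_sin,
      Real.cos_neg, Real.sin_neg]
    push_cast; ring
  have h2 : (Real.cos a : ℂ) ^ 2 + (Real.sin a : ℂ) ^ 2 = 1 := by
    exact_mod_cast Real.cos_sq_add_sin_sq a
  refine inv_eq_of_mul_eq_one_right ?_
  rw [e]
  push_cast at h1 h2 ⊢
  field_simp
  linear_combination (2 * Complex.sin a - (Complex.sin a - I * Complex.cos a)) * h2 +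
    (-2 * Complex.sin a * Complex.cos a ^ 2 -
      Complex.sin a ^ 2 * (Complex.sin a - I * Complex.cos a)) * I_sq

lemma poleResidue_eq {L : ι → ℝ} (hL : ∀ u, 0 < L u) (h : Incommensurable L) (X : ℝ) (u : ι)
    {k : ℕ} (hk : k ≠ 0) :
    poleResidue L X u k = Complex.exp ((2 * Real.pi * k * (X / L u) : ℝ) * I) /
      (2 * Real.pi * k * I) * ∏ v ∈ Finset.univ.erase u, (1 - I *
        ((Real.cos (Real.pi * k * L v / L u) / Real.sin (Real.pi * k * L v / L u) : ℝ) : ℂ)) / 2 := by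
  have hLu : (L u : ℂ) ≠ 0 := by exact_mod_cast (hL u).ne'
  rw [poleResidue]
  congr 1
  · congr 1
    · congr 1
      simp only [pole]; push_cast; ring
    · simp only [pole]; push_cast; field_simp
  · refine Finset.prod_congr rfl fun v hv => ?_
    rw [← inv_one_sub_exp]
    · congr 3
      simp only [pole]; push_cast; ring
    · intro h0
      obtain ⟨m, hm⟩ := Real.sin_eq_zero_iff.1 h0
      have h1 := (hL u).ne'
      have hpi := Real.pi_pos.ne'
      have : ((k : ℤ) : ℝ) * L v = m * L u := by
        rw [eq_div_iff h1] at hm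
        refine mul_left_cancel₀ hpi ?_
        push_cast
        linarith
      exact hk (by exact_mod_cast h v u (Finset.mem_erase.1 hv).1 _ _ this)

end Terms

/-- Partial sum over `1 ≤ k ≤ ⌊R log a⌋` of the sine series with base `a`. -/
noncomputable def sinSum (x R : ℝ) (a : ℕ) : ℝ :=
  ∑ k ∈ Finset.Icc 1 ⌊R * Real.log a⌋₊,
    Real.sin (2 * Real.pi * k * (Real.log x / Real.log a)) / k

section ResidueSums

open Complex

lemma exp_div_two_pi_mul_I (ψ k : ℝ) :
    Complex.exp (ψ * I) / (2 * Real.pi * k * I) =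
      ((Real.sin ψ / (2 * Real.pi * k) : ℝ) : ℂ) - I * ((Real.cos ψ / (2 * Real.pi * k) : ℝ) : ℂ) := by
  rw [Complex.exp_mul_I, ← Complex.ofReal_cos, ← Complex.ofReal_sin, ← div_div _ _ I, div_I]
  push_cast
  linear_combination (-(Complex.sin ψ) / (2 * Real.pi * k)) * I_sq

variable {ι : Type*} [Fintype ι] [DecidableEq ι] {L : ι → ℝ} {u v w z : ι} {a b c d : ℕ}

lemma sum_poleResidue_one (hL : ∀ u, 0 < L u) (h : Incommensurable L) (x R : ℝ)
    (he : Finset.univ.erase u = ∅) (hu : L u = Real.log a) :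
    ∑ k ∈ Finset.Icc 1 ⌊R * L u⌋₊, 2 * (poleResidue L (Real.log x) u k).re =
      1 / Real.pi * sinSum x R a := by
  rw [sinSum, hu, Finset.mul_sum]
  refine Finset.sum_congr rfl fun k hk => ?_
  have hk0 : k ≠ 0 := by have := Finset.mem_Icc.1 hk; omega
  have e := exp_div_two_pi_mul_I (2 * Real.pi * k * (Real.log x / Real.log a)) k
  rw [ofReal_natCast] at e
  rw [poleResidue_eq hL h _ u hk0, he, Finset.prod_empty, hu, e]
  simp only [mul_re, sub_re, ofReal_re, ofReal_im, I_re, I_im, one_re, one_im]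
  ring

lemma sum_poleResidue_two (hL : ∀ u, 0 < L u) (h : Incommensurable L) (x R : ℝ)
    (he : Finset.univ.erase u = {v}) (hu : L u = Real.log a) (hv : L v = Real.log b) :
    ∑ k ∈ Finset.Icc 1 ⌊R * L u⌋₊, 2 * (poleResidue L (Real.log x) u k).re =
      1 / (2 * Real.pi) * (sinSum x R a - oneCot x R a b) := by
  rw [sinSum, oneCot, hu, ← Finset.sum_sub_distrib, Finset.mul_sum]
  refine Finset.sum_congr rfl fun k hk => ?_
  have hk0 : k ≠ 0 := by have := Finset.mem_Icc.1 hk; omega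
  have e := exp_div_two_pi_mul_I (2 * Real.pi * k * (Real.log x / Real.log a)) k
  rw [ofReal_natCast] at e
  rw [poleResidue_eq hL h _ u hk0, he, Finset.prod_singleton, hu, hv, e]
  generalize Real.log x = X
  generalize 2 * Real.pi * k * (X / Real.log a) = ψ
  generalize Real.pi * k * Real.log b / Real.log a = β
  simp only [mul_re, mul_im, sub_re, sub_im, div_ofNat_re, div_ofNat_im, ofReal_re, ofReal_im,
    I_re, I_im, one_re, one_im]
  ring

lemma sum_poleResidue_three (hL : ∀ u, 0 < L u) (h : Incommensurable L) (x R : ℝ)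
    (he : Finset.univ.erase u = {v, w}) (hvw : v ≠ w) (hu : L u = Real.log a)
    (hv : L v = Real.log b) (hw : L w = Real.log c) :
    ∑ k ∈ Finset.Icc 1 ⌊R * L u⌋₊, 2 * (poleResidue L (Real.log x) u k).re =
      1 / (4 * Real.pi) * (sinSum x R a - oneCot x R a b - oneCot x R a c
        - twoCot x R a b c) := by
  rw [sinSum, oneCot, oneCot, twoCot, hu]
  simp only [← Finset.sum_sub_distrib]
  rw [Finset.mul_sum]
  refine Finset.sum_congr rfl fun k hk => ?_
  have hk0 : k ≠ 0 := by have := Finset.mem_Icc.1 hk; omega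
  have e := exp_div_two_pi_mul_I (2 * Real.pi * k * (Real.log x / Real.log a)) k
  rw [ofReal_natCast] at e
  rw [poleResidue_eq hL h _ u hk0, he, Finset.prod_pair hvw, hu, hv, hw, e]
  generalize Real.log x = X
  generalize 2 * Real.pi * k * (X / Real.log a) = ψ
  generalize Real.pi * k * Real.log b / Real.log a = β
  generalize Real.pi * k * Real.log c / Real.log a = γ
  simp only [mul_re, mul_im, sub_re, sub_im, div_ofNat_re, div_ofNat_im, ofReal_re, ofReal_im,
    I_re, I_im, one_re, one_im]
  ring

/-- exp(iψ)/i = sin ψ - i cos ψ, and each cotangent brings a factor -i. The real parts for 0, 1, 2,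
3 cotangents are therefore sin, -cos, -sin, cos, which gives the signs and the alternation of sine
and cosine. The factor 1/(8π) is 2 · 1/(2π) · 2⁻³. -/
lemma sum_poleResidue_four (hL : ∀ u, 0 < L u) (h : Incommensurable L) (x R : ℝ)
    (he : Finset.univ.erase u = {v, w, z}) (hvw : v ≠ w) (hvz : v ≠ z) (hwz : w ≠ z)
    (hu : L u = Real.log a) (hv : L v = Real.log b) (hw : L w = Real.log c)
    (hz : L z = Real.log d) :
    ∑ k ∈ Finset.Icc 1 ⌊R * L u⌋₊, 2 * (poleResidue L (Real.log x) u k).re =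
      1 / (8 * Real.pi) * (sinSum x R a - oneCot x R a b - oneCot x R a c - oneCot x R a d
        - twoCot x R a b c - twoCot x R a b d - twoCot x R a c d + threeCot x R a b c d) := by
  rw [sinSum, oneCot, oneCot, oneCot, twoCot, twoCot, twoCot, threeCot, hu]
  simp only [← Finset.sum_sub_distrib, ← Finset.sum_add_distrib]
  rw [Finset.mul_sum]
  refine Finset.sum_congr rfl fun k hk => ?_
  have hk0 : k ≠ 0 := by have := Finset.mem_Icc.1 hk; omega
  have e := exp_div_two_pi_mul_I (2 * Real.pi * k * (Real.log x / Real.log a)) k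
  rw [ofReal_natCast] at e
  rw [poleResidue_eq hL h _ u hk0, he, Finset.prod_insert (by simp [hvw, hvz]),
    Finset.prod_pair hwz, hu, hv, hw, hz, e]
  generalize Real.log x = X
  generalize 2 * Real.pi * k * (X / Real.log a) = ψ
  generalize Real.pi * k * Real.log b / Real.log a = β
  generalize Real.pi * k * Real.log c / Real.log a = γ
  generalize Real.pi * k * Real.log d / Real.log a = η
  simp only [mul_re, mul_im, sub_re, sub_im, div_ofNat_re, div_ofNat_im, ofReal_re, ofReal_im,
    I_re, I_im, one_re, one_im]
  ring

end ResidueSums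

/-! ### Convergence of the grouped series and the formula -/

section Limits

/-- The powers of `a` and of `b` are multiplicatively independent. -/
def MulIndep (a b : ℕ) : Prop :=
  ∀ m n : ℤ, (m : ℝ) * Real.log a = n * Real.log b → m = 0 ∧ n = 0

lemma MulIndep.symm {a b : ℕ} (h : MulIndep a b) : MulIndep b a :=
  fun m n e => (h n m e.symm).symm

/-- The cutoffs `R j` tend to infinity, and the products `2 R j log a` stay at a positive distance
from the integers. -/
structure GoodCutoffs (R : ℕ → ℝ) (δ : ℝ) (s : Set ℕ) : Prop where
  pos : 0 < δ
  tendsto : Tendsto R atTop atTop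
  cutoff_pos : ∀ j, 0 < R j
  one_lt : ∀ a ∈ s, 1 < a
  le_abs_sin : ∀ j, ∀ a ∈ s, δ ≤ |Real.sin (2 * Real.pi * R j * Real.log a)|

variable {R : ℕ → ℝ} {δ : ℝ} {s : Set ℕ} {x : ℝ} {a b c d : ℕ}

lemma GoodCutoffs.log_pos (hR : GoodCutoffs R δ s) (ha : a ∈ s) : 0 < Real.log a :=
  Real.log_pos (by exact_mod_cast hR.one_lt a ha)

lemma GoodCutoffs.tendsto_sum_poleResidue (hR : GoodCutoffs R δ s) {n : ℕ} (hn : n ≤ 4)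
    [Nonempty (Fin n)] {g : Fin n → ℕ} (hg : ∀ u, g u ∈ s) {L : Fin n → ℝ}
    (hLg : ∀ u, L u = Real.log (g u)) (hL : Incommensurable L) (hx : 1 ≤ x)
    {κ : Type*} [Countable κ] {lam : κ → ℝ} (hlam : IsDirichletSum lam (geomProd L)) :
    Tendsto (fun j => ∑ u, ∑ k ∈ Finset.Icc 1 ⌊R j * L u⌋₊,
      2 * (poleResidue L (Real.log x) u k).re) atTop
      (𝓝 ((∑' i, perronStep (Real.log x - lam i)) - (productPoly L (Real.log x)).coeff n)) := by
  have hL0 : ∀ u, 0 < L u := fun u => by rw [hLg]; exact hR.log_pos (hg u)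
  have := SmoothCount.tendsto_sum_poleResidue hL0 hL hR.pos hR.tendsto hR.cutoff_pos
    (fun j u => by rw [hLg]; exact hR.le_abs_sin j _ (hg u)) (Real.log_nonneg hx) hlam.1 hlam.2
    (tendsto_of_hasExpansion hn (hasExpansion_productPoly hL0 (Real.log x)))
  simpa using this

lemma tsum_perronStep_eq_sum {κ : Type*} {lam : κ → ℝ} {X : ℝ} (S : Finset κ)
    (hS : ∀ i, i ∈ S ↔ lam i ≤ X) :
    ∑' i, perronStep (X - lam i) = ∑ i ∈ S, (1 - if lam i = X then 1 / 2 else 0) := by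
  rw [tsum_eq_sum (s := S)]
  · refine Finset.sum_congr rfl fun i hi => ?_
    have := (hS i).1 hi
    have e : X - lam i = 0 ↔ lam i = X := by rw [sub_eq_zero, eq_comm]
    simp only [perronStep, e, (sub_nonneg.2 this).not_gt, if_false]
    split_ifs <;> norm_num
  · intro i hi
    rw [hS, not_le] at hi
    simp [perronStep, hi]

/-- The terms p = 0, …, ⌊X/A⌋ number ⌊X/A⌋ + 1, and the last has weight 1/2 exactly when X/A is an
integer. This is why B₁* vanishes at integers. -/
lemma tsum_perronStep_nat_mul {A X : ℝ} (hA : 0 < A) (hX : 0 ≤ X) :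
    ∑' p : ℕ, perronStep (X - p * A) = X / A + 1 / 2 - bernoulliOneStar (X / A) := by
  have ht : 0 ≤ X / A := by positivity
  have hfl : ((⌊X / A⌋₊ : ℕ) : ℝ) = X / A - Int.fract (X / A) := by
    rw [natCast_floor_eq_intCast_floor ht, Int.self_sub_fract]
  rw [tsum_perronStep_eq_sum (Finset.range (⌊X / A⌋₊ + 1)) (fun p => by
    rw [Finset.mem_range, Nat.lt_succ_iff, Nat.le_floor_iff ht, le_div_iff₀ hA])]
  rw [Finset.sum_sub_distrib, Finset.sum_const, Finset.card_range, nsmul_eq_mul, mul_one]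
  have hp : ∀ p : ℕ, (p : ℝ) * A = X ↔ (p : ℝ) = X / A := fun p => (eq_div_iff hA.ne').symm
  simp only [hp, bernoulliOneStar]
  push_cast
  split_ifs with h0
  · rw [h0, sub_zero] at hfl
    have : ∀ p : ℕ, (p : ℝ) = X / A ↔ p = ⌊X / A⌋₊ := fun p => by
      rw [← hfl, Nat.cast_inj, Nat.floor_natCast]
    simp only [this, Finset.sum_ite_eq', Finset.mem_range, Nat.lt_succ_self, if_true, hfl]
    ring
  · have : ∀ p : ℕ, (p : ℝ) ≠ X / A := fun p e => h0 (by rw [← e, Int.fract_natCast])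
    simp only [this, if_false, Finset.sum_const_zero, hfl]
    ring

/-- Conditional convergence of the Fourier series of the first Bernoulli function. -/
lemma GoodCutoffs.tendsto_sinSum (hR : GoodCutoffs R δ s) (ha : a ∈ s) (hx : 1 ≤ x) :
    Tendsto (fun j => sinSum x (R j) a) atTop
      (𝓝 (-Real.pi * bernoulliOneStar (Real.log x / Real.log a))) := by
  have hA := hR.log_pos ha
  have hinc : Incommensurable ![Real.log a] := fun u v huv => (huv (Subsingleton.elim _ _)).elim
  have hD : IsDirichletSum (fun p : ℕ => p * Real.log a) (geomProd ![Real.log a]) := by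
    have := isDirichletSum_geometric hA
    unfold geomProd
    simpa using this
  have h := hR.tendsto_sum_poleResidue (by norm_num) (g := ![a]) (by simpa using ha)
    (by simp) hinc hx hD
  have hL0 : ∀ u, 0 < ![Real.log a] u := by simpa using hA
  rw [tsum_perronStep_nat_mul hA (Real.log_nonneg hx), coeff_productPoly_one] at h
  have h2 := h.const_mul Real.pi
  have e : Real.pi * (Real.log x / Real.log a + 1 / 2 -
      bernoulliOneStar (Real.log x / Real.log a) - (Real.log x / Real.log a + 1 / 2)) =
      -Real.pi * bernoulliOneStar (Real.log x / Real.log a) := by ring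
  rw [e] at h2
  refine h2.congr fun j => ?_
  rw [Fin.sum_univ_one, sum_poleResidue_one hL0 hinc x (R j) (u := 0) (by decide) rfl]
  have := Real.pi_pos.ne'
  field_simp

/-- The residue formula for two bases expresses the grouped sum through two convergent sine sums and
a convergent residue sum. -/
lemma GoodCutoffs.exists_hasPairSum (hR : GoodCutoffs R δ s) (ha : a ∈ s) (hb : b ∈ s)
    (hab : MulIndep a b) (hx : 1 ≤ x) : ∃ P, HasPairSum R x a b P := by
  have hA := hR.log_pos ha
  have hB := hR.log_pos hb
  have hinc : Incommensurable ![Real.log a, Real.log b] := by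
    intro u v huv m n e
    fin_cases u <;> fin_cases v
    · exact absurd rfl huv
    · exact (hab m n e).1
    · exact (hab.symm m n e).1
    · exact absurd rfl huv
  have hD : IsDirichletSum (fun p : ℕ × ℕ => p.1 * Real.log a + p.2 * Real.log b)
      (geomProd ![Real.log a, Real.log b]) := by
    have := (isDirichletSum_geometric hA).mul (isDirichletSum_geometric hB)
    unfold geomProd
    simpa [Fin.prod_univ_two, -Finset.prod_inv_distrib] using this
  have h := hR.tendsto_sum_poleResidue (by norm_num) (g := ![a, b])
    (by simp [Fin.forall_fin_two, ha, hb]) (by simp [Fin.forall_fin_two]) hinc hx hD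
  have hL0 : ∀ u, 0 < ![Real.log a, Real.log b] u := by simp [Fin.forall_fin_two, hA, hB]
  have sa := hR.tendsto_sinSum ha hx
  have sb := hR.tendsto_sinSum hb hx
  refine ⟨_, ((sa.add sb).sub (h.const_mul (2 * Real.pi))).congr fun j => ?_⟩
  rw [Fin.sum_univ_two,
    sum_poleResidue_two hL0 hinc x (R j) (u := 0) (v := 1) (by decide) rfl rfl,
    sum_poleResidue_two hL0 hinc x (R j) (u := 1) (v := 0) (by decide) rfl rfl]
  have := Real.pi_pos.ne'
  field_simp
  ring

/-- In the formula for three bases the one-cotangent sums regroup into the three pair sums, already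
known to converge; only the triple sum is new. -/
lemma GoodCutoffs.exists_hasTripleSum (hR : GoodCutoffs R δ s) (ha : a ∈ s) (hb : b ∈ s)
    (hc : c ∈ s) (hab : MulIndep a b) (hac : MulIndep a c) (hbc : MulIndep b c) (hx : 1 ≤ x) :
    ∃ T, HasTripleSum R x a b c T := by
  have hA := hR.log_pos ha
  have hB := hR.log_pos hb
  have hC := hR.log_pos hc
  have hinc : Incommensurable ![Real.log a, Real.log b, Real.log c] := by
    intro u v huv m n e
    fin_cases u <;> fin_cases v
    · exact absurd rfl huv
    · exact (hab m n e).1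
    · exact (hac m n e).1
    · exact (hab.symm m n e).1
    · exact absurd rfl huv
    · exact (hbc m n e).1
    · exact (hac.symm m n e).1
    · exact (hbc.symm m n e).1
    · exact absurd rfl huv
  have hD : IsDirichletSum
      (fun p : ℕ × ℕ × ℕ => p.1 * Real.log a + (p.2.1 * Real.log b + p.2.2 * Real.log c))
      (geomProd ![Real.log a, Real.log b, Real.log c]) := by
    have := (isDirichletSum_geometric hA).mul
      ((isDirichletSum_geometric hB).mul (isDirichletSum_geometric hC))
    unfold geomProd
    simpa [Fin.prod_univ_three, mul_assoc, -Finset.prod_inv_distrib] using this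
  have h := hR.tendsto_sum_poleResidue (by norm_num) (g := ![a, b, c])
    (by simp [Fin.forall_fin_succ, ha, hb, hc]) (by simp [Fin.forall_fin_succ]) hinc hx hD
  have hL0 : ∀ u, 0 < ![Real.log a, Real.log b, Real.log c] u := by
    simp [Fin.forall_fin_succ, hA, hB, hC]
  have sa := hR.tendsto_sinSum ha hx
  have sb := hR.tendsto_sinSum hb hx
  have sc := hR.tendsto_sinSum hc hx
  obtain ⟨Pab, hPab⟩ := hR.exists_hasPairSum ha hb hab hx
  obtain ⟨Pac, hPac⟩ := hR.exists_hasPairSum ha hc hac hx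
  obtain ⟨Pbc, hPbc⟩ := hR.exists_hasPairSum hb hc hbc hx
  refine ⟨_, ((((sa.add sb).add sc).sub ((hPab.add hPac).add hPbc)).sub
    (h.const_mul (4 * Real.pi))).congr fun j => ?_⟩
  rw [Fin.sum_univ_three,
    sum_poleResidue_three hL0 hinc x (R j) (u := 0) (v := 1) (w := 2) (by decide) (by decide)
      rfl rfl rfl,
    sum_poleResidue_three hL0 hinc x (R j) (u := 1) (v := 0) (w := 2) (by decide) (by decide)
      rfl rfl rfl,
    sum_poleResidue_three hL0 hinc x (R j) (u := 2) (v := 0) (w := 1) (by decide) (by decide)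
      rfl rfl rfl]
  have := Real.pi_pos.ne'
  field_simp
  ring

/-- By uniqueness at most one exponent vector attains x, so the half weight at the jump costs
exactly χ/2. -/
lemma tsum_perronStep_eq_count (ha : 1 < a) (hb : 1 < b) (hc : 1 < c) (hd : 1 < d)
    (hrep : UniqueRep a b c d) (hx : 1 ≤ x) :
    ∑' e : ℕ × ℕ × ℕ × ℕ, perronStep (Real.log x - (e.1 * Real.log a + (e.2.1 * Real.log b +
      (e.2.2.1 * Real.log c + e.2.2.2 * Real.log d)))) =
      count a b c d x - 1 / 2 * chi a b c d x := by
  classical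
  have hx0 : 0 < x := by linarith
  set lam : ℕ × ℕ × ℕ × ℕ → ℝ := fun e => e.1 * Real.log a + (e.2.1 * Real.log b +
      (e.2.2.1 * Real.log c + e.2.2.2 * Real.log d)) with hlam
  set val : ℕ × ℕ × ℕ × ℕ → ℕ := fun e =>
    a ^ e.1 * b ^ e.2.1 * c ^ e.2.2.1 * d ^ e.2.2.2 with hval
  have hpos : ∀ e, 0 < (val e : ℝ) := fun e => by
    have : 0 < val e := by simp only [hval]; positivity
    exact_mod_cast this
  have hlog : ∀ e, lam e = Real.log (val e) := fun e => by
    have : (a : ℝ) ≠ 0 := by positivity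
    have : (b : ℝ) ≠ 0 := by positivity
    have : (c : ℝ) ≠ 0 := by positivity
    have : (d : ℝ) ≠ 0 := by positivity
    simp only [hval, hlam]
    push_cast
    rw [Real.log_mul (by positivity) (by positivity), Real.log_mul (by positivity) (by positivity),
      Real.log_mul (by positivity) (by positivity), Real.log_pow, Real.log_pow, Real.log_pow,
      Real.log_pow]
    ring
  have hle : ∀ e, lam e ≤ Real.log x ↔ (val e : ℝ) ≤ x := fun e => by
    rw [hlog, Real.log_le_log_iff (hpos e) hx0]
  have heq : ∀ e, lam e = Real.log x ↔ (val e : ℝ) = x := fun e => by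
    rw [hlog, Real.log_injOn_pos.eq_iff (Set.mem_Ioi.2 (hpos e)) (Set.mem_Ioi.2 hx0)]
  have hinj : Function.Injective val := hrep
  have hfin : {e | (val e : ℝ) ≤ x}.Finite := by
    refine ((Set.finite_Iic ⌊x⌋₊).preimage hinj.injOn).subset fun e he => ?_
    exact Nat.le_floor he
  rw [tsum_perronStep_eq_sum (lam := lam) hfin.toFinset (fun e => by simp [hle]),
    Finset.sum_sub_distrib, Finset.sum_const, nsmul_eq_mul, mul_one,
    ← Set.ncard_eq_toFinset_card _ hfin]
  congr 1
  simp only [heq, chi]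
  by_cases hmem : x ∈ smoothSet a b c d
  · rw [Set.indicator_of_mem hmem, mul_one]
    obtain ⟨p, q, l, f, hxe⟩ := hmem
    have : ∀ e, (val e : ℝ) = x ↔ e = (p, q, l, f) := fun e => by
      rw [hxe, Nat.cast_inj]
      exact hinj.eq_iff (b := (p, q, l, f))
    simp only [this, Finset.sum_ite_eq']
    rw [if_pos]
    rw [Set.Finite.mem_toFinset]
    exact hxe.ge
  · rw [Set.indicator_of_notMem hmem, mul_zero]
    refine Finset.sum_eq_zero fun e _ => if_neg fun h => hmem ⟨e.1, e.2.1, e.2.2.1, e.2.2.2, h.symm⟩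

theorem GoodCutoffs.cotFormula (hR : GoodCutoffs R δ s) (ha : a ∈ s) (hb : b ∈ s)
    (hc : c ∈ s) (hd : d ∈ s) (hab : MulIndep a b) (hac : MulIndep a c) (had : MulIndep a d)
    (hbc : MulIndep b c) (hbd : MulIndep b d) (hcd : MulIndep c d) (hrep : UniqueRep a b c d)
    (hx : 1 ≤ x) : CotFormula a b c d R x := by
  have hA := hR.log_pos ha
  have hB := hR.log_pos hb
  have hC := hR.log_pos hc
  have hDd := hR.log_pos hd
  have hinc : Incommensurable ![Real.log a, Real.log b, Real.log c, Real.log d] := by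
    intro u v huv m n e
    fin_cases u <;> fin_cases v
    · exact absurd rfl huv
    · exact (hab m n e).1
    · exact (hac m n e).1
    · exact (had m n e).1
    · exact (hab.symm m n e).1
    · exact absurd rfl huv
    · exact (hbc m n e).1
    · exact (hbd m n e).1
    · exact (hac.symm m n e).1
    · exact (hbc.symm m n e).1
    · exact absurd rfl huv
    · exact (hcd m n e).1
    · exact (had.symm m n e).1
    · exact (hbd.symm m n e).1
    · exact (hcd.symm m n e).1
    · exact absurd rfl huv
  have hD : IsDirichletSum (fun e : ℕ × ℕ × ℕ × ℕ => e.1 * Real.log a + (e.2.1 * Real.log b +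
      (e.2.2.1 * Real.log c + e.2.2.2 * Real.log d)))
      (geomProd ![Real.log a, Real.log b, Real.log c, Real.log d]) := by
    have := (isDirichletSum_geometric hA).mul ((isDirichletSum_geometric hB).mul
      ((isDirichletSum_geometric hC).mul (isDirichletSum_geometric hDd)))
    unfold geomProd
    simpa [Fin.prod_univ_four, mul_assoc, -Finset.prod_inv_distrib] using this
  have h := hR.tendsto_sum_poleResidue (by norm_num) (g := ![a, b, c, d])
    (by simp [Fin.forall_fin_succ, ha, hb, hc, hd]) (by simp [Fin.forall_fin_succ]) hinc hx hD
  rw [tsum_perronStep_eq_count (hR.one_lt a ha) (hR.one_lt b hb) (hR.one_lt c hc)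
    (hR.one_lt d hd) hrep hx, coeff_productPoly_four hA hB hC hDd] at h
  have hL0 : ∀ u, 0 < ![Real.log a, Real.log b, Real.log c, Real.log d] u := by
    simp [Fin.forall_fin_succ, hA, hB, hC, hDd]
  have sa := hR.tendsto_sinSum ha hx
  have sb := hR.tendsto_sinSum hb hx
  have sc := hR.tendsto_sinSum hc hx
  have sd := hR.tendsto_sinSum hd hx
  obtain ⟨Pab, hPab⟩ := hR.exists_hasPairSum ha hb hab hx
  obtain ⟨Pac, hPac⟩ := hR.exists_hasPairSum ha hc hac hx
  obtain ⟨Pad, hPad⟩ := hR.exists_hasPairSum ha hd had hx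
  obtain ⟨Pbc, hPbc⟩ := hR.exists_hasPairSum hb hc hbc hx
  obtain ⟨Pbd, hPbd⟩ := hR.exists_hasPairSum hb hd hbd hx
  obtain ⟨Pcd, hPcd⟩ := hR.exists_hasPairSum hc hd hcd hx
  obtain ⟨Tabc, hTabc⟩ := hR.exists_hasTripleSum ha hb hc hab hac hbc hx
  obtain ⟨Tabd, hTabd⟩ := hR.exists_hasTripleSum ha hb hd hab had hbd hx
  obtain ⟨Tacd, hTacd⟩ := hR.exists_hasTripleSum ha hc hd hac had hcd hx
  obtain ⟨Tbcd, hTbcd⟩ := hR.exists_hasTripleSum hb hc hd hbc hbd hcd hx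
  have hpi := Real.pi_pos.ne'
  -- Q is the limit obtained by solving the four-base identity for the quadruple sum. The sine sums
  -- enter the final formula through their limits -π B₁*.
  refine ⟨Pab, Pac, Pad, Pbc, Pbd, Pcd, Tabc, Tabd, Tacd, Tbcd, _, hPab, hPac, hPad, hPbc, hPbd,
    hPcd, hTabc, hTabd, hTacd, hTbcd, ((h.const_mul (8 * Real.pi)).sub
      (((sa.add sb).add sc).add sd)).add
      ((((((hPab.add hPac).add hPad).add hPbc).add hPbd).add hPcd).add
        (((hTabc.add hTabd).add hTacd).add hTbcd)) |>.congr fun j => ?_, ?_⟩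
  · rw [Fin.sum_univ_four,
      sum_poleResidue_four hL0 hinc x (R j) (u := 0) (v := 1) (w := 2) (z := 3) (by decide)
        (by decide) (by decide) (by decide) rfl rfl rfl rfl,
      sum_poleResidue_four hL0 hinc x (R j) (u := 1) (v := 0) (w := 2) (z := 3) (by decide)
        (by decide) (by decide) (by decide) rfl rfl rfl rfl,
      sum_poleResidue_four hL0 hinc x (R j) (u := 2) (v := 0) (w := 1) (z := 3) (by decide)
        (by decide) (by decide) (by decide) rfl rfl rfl rfl,
      sum_poleResidue_four hL0 hinc x (R j) (u := 3) (v := 0) (w := 1) (z := 2) (by decide)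
        (by decide) (by decide) (by decide) rfl rfl rfl rfl]
    field_simp
    ring
  · generalize mainPoly _ _ _ _ _ = M
    field_simp
    ring

end Limits

/-! ### Independence from unique representation -/

section UniqueRep

lemma mulIndep_of_pow_ne {a b : ℕ} (ha : 1 < a) (hb : 1 < b)
    (h : ∀ m n : ℕ, a ^ m = b ^ n → m = 0) : MulIndep a b := by
  have hA : 0 < Real.log a := Real.log_pos (by exact_mod_cast ha)
  have hB : 0 < Real.log b := Real.log_pos (by exact_mod_cast hb)
  -- For m ≥ 0 the positive logarithms force n ≥ 0, so the relation becomes an equality of natural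
  -- powers; the case m ≤ 0 follows by negating both exponents.
  have key : ∀ m n : ℤ, 0 ≤ m → (m : ℝ) * Real.log a = n * Real.log b → m = 0 := by
    intro m n hm e
    have hn : (0 : ℝ) ≤ n := by
      have : 0 ≤ (m : ℝ) * Real.log a := mul_nonneg (by exact_mod_cast hm) hA.le
      rw [e] at this
      exact nonneg_of_mul_nonneg_left this hB
    lift m to ℕ using hm
    lift n to ℕ using (by exact_mod_cast hn)
    push_cast at e
    rw [← Real.log_pow, ← Real.log_pow] at e
    have e2 := Real.log_injOn_pos (Set.mem_Ioi.2 (by positivity)) (Set.mem_Ioi.2 (by positivity)) e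
    exact_mod_cast h m n (by exact_mod_cast e2)
  intro m n e
  have hm : m = 0 := by
    rcases le_total 0 m with h0 | h0
    · exact key m n h0 e
    · have := key (-m) (-n) (by omega) (by push_cast; linarith)
      omega
  refine ⟨hm, ?_⟩
  rw [hm, Int.cast_zero, zero_mul] at e
  have := (mul_eq_zero.1 e.symm).resolve_right hB.ne'
  exact_mod_cast this

variable {a b c d : ℕ}

/-- The bases 0 and 1 satisfy a = a², giving two representations of the same number. -/
lemma UniqueRep.one_lt (h : UniqueRep a b c d) : 1 < a := by
  by_contra! ha
  have h1 : ((1, 0, 0, 0) : ℕ × ℕ × ℕ × ℕ) = (2, 0, 0, 0) := h (by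
    interval_cases a <;> simp)
  simp at h1

lemma uniqueRep_two_three_five_seven : UniqueRep 2 3 5 7 := by
  have h2 : Nat.Prime 2 := by norm_num
  have h3 : Nat.Prime 3 := by norm_num
  have h5 : Nat.Prime 5 := by norm_num
  have h7 : Nat.Prime 7 := by norm_num
  have hf : ∀ p q l f : ℕ, (2 ^ p * 3 ^ q * 5 ^ l * 7 ^ f).factorization =
      Finsupp.single 2 p + Finsupp.single 3 q + Finsupp.single 5 l + Finsupp.single 7 f := by
    intro p q l f
    rw [Nat.factorization_mul (by positivity) (by positivity),
      Nat.factorization_mul (by positivity) (by positivity),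
      Nat.factorization_mul (by positivity) (by positivity), h2.factorization_pow,
      h3.factorization_pow, h5.factorization_pow, h7.factorization_pow]
  rintro ⟨p, q, l, f⟩ ⟨p', q', l', f'⟩ e
  have e' := congrArg Nat.factorization e
  simp only [hf] at e'
  have e2 := DFunLike.congr_fun e' 2
  have e3 := DFunLike.congr_fun e' 3
  have e5 := DFunLike.congr_fun e' 5
  have e7 := DFunLike.congr_fun e' 7
  simp at e2 e3 e5 e7
  simp [*]

theorem exists_cutoffs_cotFormula (hab : a < b) (hbc : b < c) (hcd : c < d)
    (h : UniqueRep a b c d) : ∃ R : ℕ → ℝ, Tendsto R atTop atTop ∧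
      ∀ x : ℝ, 1 ≤ x → CotFormula a b c d R x := by
  have ha := h.one_lt
  have hb := ha.trans hab
  have hc := hb.trans hbc
  have hd := hc.trans hcd
  have hlog : ∀ n : ℕ, 1 < n → 0 < Real.log n := fun n hn => Real.log_pos (by exact_mod_cast hn)
  obtain ⟨δ, hδ, R, hR, hR0, hsin⟩ := exists_good_sequence
    [Real.log a, Real.log b, Real.log c, Real.log d] (by
      simp [hlog a ha, hlog b hb, hlog c hc, hlog d hd])
  have good : GoodCutoffs R δ {a, b, c, d} :=
    ⟨hδ, hR, hR0, by simp [ha, hb, hc, hd], fun j n hn => hsin j _ (by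
      rcases hn with rfl | rfl | rfl | rfl <;> simp)⟩
  refine ⟨R, hR, fun x hx => good.cotFormula (by simp) (by simp) (by simp) (by simp)
    (mulIndep_of_pow_ne ha hb fun m n e => ?_) (mulIndep_of_pow_ne ha hc fun m n e => ?_)
    (mulIndep_of_pow_ne ha hd fun m n e => ?_) (mulIndep_of_pow_ne hb hc fun m n e => ?_)
    (mulIndep_of_pow_ne hb hd fun m n e => ?_) (mulIndep_of_pow_ne hc hd fun m n e => ?_) h hx⟩
  · have := @h (m, 0, 0, 0) (0, n, 0, 0) (by simpa using e); simp_all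
  · have := @h (m, 0, 0, 0) (0, 0, n, 0) (by simpa using e); simp_all
  · have := @h (m, 0, 0, 0) (0, 0, 0, n) (by simpa using e); simp_all
  · have := @h (0, m, 0, 0) (0, 0, n, 0) (by simpa using e); simp_all
  · have := @h (0, m, 0, 0) (0, 0, 0, n) (by simpa using e); simp_all
  · have := @h (0, 0, m, 0) (0, 0, 0, n) (by simpa using e); simp_all

end UniqueRep

end SmoothCount

theorem corollary16 :
    (∀ a b c d : ℕ, a < b → b < c → c < d →
      Nat.gcd a (Nat.gcd b (Nat.gcd c d)) = 1 →
      SmoothCount.UniqueRep a b c d →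
      ∃ R : ℕ → ℝ, Tendsto R atTop atTop ∧
        ∀ x : ℝ, 1 ≤ x → SmoothCount.CotFormula a b c d R x) ∧
    (∃ R : ℕ → ℝ, Tendsto R atTop atTop ∧
        ∀ x : ℝ, 1 ≤ x → SmoothCount.CotFormula 2 3 5 7 R x) :=
  ⟨fun _ _ _ _ hab hbc hcd _ h => SmoothCount.exists_cutoffs_cotFormula hab hbc hcd h,
    SmoothCount.exists_cutoffs_cotFormula (by norm_num) (by norm_num) (by norm_num)
      SmoothCount.uniqueRep_two_three_five_seven⟩
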